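/- **Model.** Seller types have a law with continuous distribution function $F$ and support $[\underline\theta,\overline\theta]$, $\underline\theta<\overline\theta$. A type-$\theta$ seller produces quality $q\ge 0$ at cost $C(q,\theta)$, where $C$ is $C^2$ on $[0,\infty)\times[\underline\theta,\overline\theta]$, $C_q\ge0$, $C_\theta\le0$, $C_{qq}\ge0$, $C_{q\theta}\le0$, $C(0,\theta)=0$ and $C_q(0,\theta)=0$. A rating system is a signal space $S$ with a signal distribution $\pi(\cdot\mid q)$ for every quality $q$. Given a cutoff $c$, an *equilibrium* in which exactly the types in $[c,\overline\theta]$ produce consists of a rating system, integrable quality choices $q(\theta)$, and nonnegative prices $p(s)$ with finite mean under every $\pi(\cdot\mid q')$, such that $p(s)=\mathbb E[q\mid s]$ almost surely (given $\theta\ge c$), every $\theta\ge c$ chooses $q(\theta)$ to maximize $\int p\,d\pi(\cdot\mid q')-C(q',\theta)$ over $q'\ge0$, and its profit $\Pi(\theta)$ (the maximum, before any fee) is nonnegative. The signaled quality is $\overline q(\theta)=\int p\,d\pi(\cdot\mid q(\theta))$. If the intermediary charges a flat entry fee $e\ge 0$, an *entry equilibrium with cutoff $c$* is such an equilibrium in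 which moreover $\Pi(\theta)\ge e$ for all $\theta\ge c$, while no type $\theta<c$ can obtain a payoff (before the fee) above $e$. The revenue is $e\,(1-F(c))$. The intermediary chooses the fee and the rating system, together with a resulting entry equilibrium, to maximize revenue. **Proposition.** 1. For every entry cutoff $c\in[\underline\theta,\overline\theta)$: a fee $e$ and a rating system (with its equilibrium) maximize revenue among all entry equilibria with cutoff $c$ if and only if $e=\Pi(c)$ and the rating system maximizes the profit $\Pi(c)$ of the cutoff type among all equilibria in which the types in $[c,\overline\theta]$ produce, that is, it solves the low-quality-optimal problem on $[c,\overline\theta]$ with all the welfare weight on the lowest producing type. 2. Let a fee $e$ and a rating system, with entry cutoff $c$, qualities $q$ and signaled qualities $\overline q$, maximize revenue among all entry equilibria. Then $c<\overline\theta$, $e=\Pi(c)$, and the rating system is low-quality-optimal on $[c,\overline\theta]$ in the sense of part 1. If $C$ is strictly submodular (that is, $C(q',\theta')-C(q,\theta')<C(q',\theta)-C(q,\theta)$ for $q<q'$, $\theta<\theta'$), the rating is full mixing: there are a number $x\ge0$ and a function $\alpha$ of quality such that for all $\theta\in[c,\overline\theta)$ $$\alpha(q(\theta))\in[0,1),\qquad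 \overline q(\theta)=\alpha(q(\theta))\,q(\theta)+\bigl(1-\alpha(q(\theta))\bigr)\,x ,$$ and the same qualities and signaled qualities of the types in $[c,\overline\theta)$ arise, in an entry equilibrium with the same fee and cutoff (hence also revenue maximizing), from a rating system that reveals each chosen quality $q$ with probability $\alpha(q)$ and with probability $1-\alpha(q)$ sends one generic signal, common to all qualities, whose price is $x$ (a revealed quality $q$ has price $q$). Without strict submodularity, the same conclusion holds with $\alpha\in[0,1]$ in place of $\alpha\in[0,1)$, provided $q$ is nondecreasing in type on $[c,\overline\theta]$. -/

import Mathlib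

open MeasureTheory ProbabilityTheory Set
open scoped NNReal ENNReal

noncomputable section

/-- `C_q`: the partial derivative in quality, on the domain `q ≥ 0`. -/
def costQ (C : ℝ → ℝ → ℝ) (q θ : ℝ) : ℝ :=
  derivWithin (fun x => C x θ) (Ici 0) q

/-- `C_θ`: the partial derivative in the type, on the type interval `[lo, hi]`. -/
def costT (lo hi : ℝ) (C : ℝ → ℝ → ℝ) (q θ : ℝ) : ℝ :=
  derivWithin (fun t => C q t) (Icc lo hi) θ

/-- A market: a continuous distribution of seller types with support `[lo, hi]`, and a cost
function `cost q θ` with `C_q ≥ 0`, `C_θ ≤ 0`, `C_qq ≥ 0`, `C_qθ ≤ 0`, `C(0, θ) = 0`,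
`C_q(0, θ) = 0`. -/
structure Market where
  lo : ℝ
  hi : ℝ
  lo_lt_hi : lo < hi
  /-- the law of the seller's type -/
  F : Measure ℝ
  prob : IsProbabilityMeasure F
  /-- the distribution function is continuous -/
  nullSingleton : NullSingletonClass F
  support_eq : F.support = Icc lo hi
  cost : ℝ → ℝ → ℝ
  smooth : ContDiffOn ℝ 2 (Function.uncurry cost) (Ici 0 ×ˢ Icc lo hi)
  costQ_nonneg : ∀ q, 0 ≤ q → ∀ θ ∈ Icc lo hi, 0 ≤ costQ cost q θ
  costT_nonpos : ∀ q, 0 ≤ q → ∀ θ ∈ Icc lo hi, costT lo hi cost q θ ≤ 0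
  costQQ_nonneg : ∀ q, 0 ≤ q → ∀ θ ∈ Icc lo hi, 0 ≤ costQ (costQ cost) q θ
  costQT_nonpos : ∀ q, 0 ≤ q → ∀ θ ∈ Icc lo hi, costT lo hi (costQ cost) q θ ≤ 0
  cost_zero : ∀ θ ∈ Icc lo hi, cost 0 θ = 0
  costQ_zero : ∀ θ ∈ Icc lo hi, costQ cost 0 θ = 0

attribute [instance] Market.prob Market.nullSingleton

/-- `cost` is strictly submodular. -/
def Market.StrictlySubmodular (M : Market) : Prop :=
  ∀ q q' θ θ' : ℝ, 0 ≤ q → q < q' → θ ∈ Icc M.lo M.hi → θ' ∈ Icc M.lo M.hi → θ < θ' →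
    M.cost q' θ' - M.cost q θ' < M.cost q' θ - M.cost q θ

/-- A rating system (a signal space and a signal distribution for every quality), together with
the sellers' quality choices and the prices of the signals. -/
structure RatedMarket where
  S : Type
  mS : MeasurableSpace S
  /-- the rating system: the distribution of the signal given the quality -/
  rating : Kernel ℝ≥0 S
  markov : IsMarkovKernel rating
  /-- the quality chosen by each type; only its values on producing types matter -/
  quality : ℝ → ℝ≥0
  measurable_quality : Measurable quality
  /-- the price of each signal -/
  price : S → ℝ≥0
  measurable_price : Measurable price

attribute [instance] RatedMarket.mS RatedMarket.markov

namespace RatedMarket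

/-- The expected price of a seller who produces quality `z`. -/
def expectedPrice (A : RatedMarket) (z : ℝ≥0) : ℝ := ∫ s, (A.price s : ℝ) ∂(A.rating z)

/-- Payoff, before any fee, of a type-`θ` seller who produces quality `z`. -/
def payoff (A : RatedMarket) (M : Market) (z : ℝ≥0) (θ : ℝ) : ℝ :=
  A.expectedPrice z - M.cost z θ

/-- The signaled quality of type `θ`. -/
def signaled (A : RatedMarket) (θ : ℝ) : ℝ := A.expectedPrice (A.quality θ)

/-- The profit, before any fee, of type `θ`. -/
def profit (A : RatedMarket) (M : Market) (θ : ℝ) : ℝ := A.payoff M (A.quality θ) θ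

/-- Joint (unnormalized) law of type and signal among the sellers with types in `[c, hi]`. -/
def joint (A : RatedMarket) (M : Market) (c : ℝ) : Measure (ℝ × A.S) :=
  (M.F.restrict (Icc c M.hi)) ⊗ₘ (A.rating.comap A.quality A.measurable_quality)

end RatedMarket

/-- Equilibrium of the market in which exactly the types in `[c, hi]` produce: the price of a
signal is the conditional expectation of quality given the signal, every producing type chooses
an optimal quality, and it gets at least its outside option `0`. Prices of signals that are not
sent in equilibrium are only required to be nonnegative. -/
structure IsEquilibrium (M : Market) (c : ℝ) (A : RatedMarket) : Prop where
  cutoff_mem : c ∈ Icc M.lo M.hi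
  integrable_quality : IntegrableOn (fun θ => (A.quality θ : ℝ)) (Icc c M.hi) M.F
  integrable_price : ∀ z : ℝ≥0, Integrable (fun s => (A.price s : ℝ)) (A.rating z)
  price_eq : (fun w : ℝ × A.S => (A.price w.2 : ℝ)) =ᵐ[A.joint M c]
    (A.joint M c)[fun w : ℝ × A.S => (A.quality w.1 : ℝ) |
      MeasurableSpace.comap Prod.snd A.mS]
  optimal : ∀ θ ∈ Icc c M.hi, ∀ z : ℝ≥0, A.payoff M z θ ≤ A.profit M θ
  participate : ∀ θ ∈ Icc c M.hi, 0 ≤ A.profit M θ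

/-- Equilibrium when the intermediary charges the flat entry fee `e`: the types from the cutoff
`c` on enter, and it is optimal for them to do so; no type below `c` could gain by entering. -/
structure IsEntryEquilibrium (M : Market) (e c : ℝ) (A : RatedMarket) : Prop where
  fee_nonneg : 0 ≤ e
  equilibrium : IsEquilibrium M c A
  enter : ∀ θ ∈ Icc c M.hi, e ≤ A.profit M θ
  stay_out : ∀ θ ∈ Ico M.lo c, ∀ z : ℝ≥0, A.payoff M z θ ≤ e

/-- The intermediary's revenue from the fee `e` when the types from `c` on enter. -/
def revenue (M : Market) (e c : ℝ) : ℝ := e * (1 - cdf M.F c)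

/-- Fee and rating system (with the entry and quality decisions they induce) maximize revenue. -/
def IsRevenueMaximizing (M : Market) (e c : ℝ) (A : RatedMarket) : Prop :=
  IsEntryEquilibrium M e c A ∧
    ∀ e' c' A', IsEntryEquilibrium M e' c' A' → revenue M e' c' ≤ revenue M e c

/-- Fee and rating system maximize revenue given the entry cutoff `c`. -/
def IsRevenueMaximizingAt (M : Market) (c e : ℝ) (A : RatedMarket) : Prop :=
  IsEntryEquilibrium M e c A ∧
    ∀ e' A', IsEntryEquilibrium M e' c A' → revenue M e' c ≤ revenue M e c

/-- When the types in `[c, hi]` produce, the rating system maximizes the weighted total profit of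
the sellers, with welfare weights given by the measure `Λ` on types. The case `Λ = dirac c` is
the low-quality-optimal problem with all the weight on the lowest producing type. -/
def IsParetoOptimal (M : Market) (c : ℝ) (Λ : Measure ℝ) (A : RatedMarket) : Prop :=
  IsEquilibrium M c A ∧
    ∀ A', IsEquilibrium M c A' → ∫ θ, A'.profit M θ ∂Λ ≤ ∫ θ, A.profit M θ ∂Λ

/-- On the qualities chosen by the types in `T`, the rating system reveals the quality `z` with
probability `α z` and otherwise sends a generic signal, the same for all qualities. A revealed
quality is priced at that quality, the generic signal at `x`. -/
def RatedMarket.RevealsOrPools (A : RatedMarket) (T : Set ℝ) (α : ℝ≥0 → ℝ) (x : ℝ≥0) : Prop :=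
  ∃ (reveal : ℝ≥0 → A.S) (generic : A.S),
    MeasurableEmbedding reveal ∧ MeasurableSet {generic} ∧ generic ∉ range reveal ∧
    A.price generic = x ∧
    ∀ θ ∈ T, A.price (reveal (A.quality θ)) = A.quality θ ∧
      A.rating (A.quality θ) =
        ENNReal.ofReal (α (A.quality θ)) • Measure.dirac (reveal (A.quality θ)) +
          ENNReal.ofReal (1 - α (A.quality θ)) • Measure.dirac generic

/-- Mixing with revelation probabilities in `I`: the signaled quality of every type in `[c, hi)`
is `α q + (1 - α) x` with `α ∈ I`, one generic quality `x`, and the same qualities and signaled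
qualities are implemented, with the same fee and cutoff, by the rating system that reveals the
quality with probability `α` and otherwise sends a generic signal priced `x`. The type `hi` alone
has measure zero and is left out. -/
def IsMixing (I : Set ℝ) (M : Market) (e c : ℝ) (A : RatedMarket) : Prop :=
  ∃ (α : ℝ≥0 → ℝ) (x : ℝ≥0),
    (∀ θ ∈ Ico c M.hi, α (A.quality θ) ∈ I ∧
      A.signaled θ = α (A.quality θ) * A.quality θ + (1 - α (A.quality θ)) * x) ∧
    ∃ A' : RatedMarket, IsEntryEquilibrium M e c A' ∧
      (∀ θ ∈ Ico c M.hi, A'.quality θ = A.quality θ ∧ A'.signaled θ = A.signaled θ) ∧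
      A'.RevealsOrPools (Ico c M.hi) α x

/-- Full mixing: every type's quality is mixed into the generic signal with positive
probability. -/
def IsFullMixing (M : Market) (e c : ℝ) (A : RatedMarket) : Prop :=
  IsMixing (Ico 0 1) M e c A

end

/-- The domain of a cost function. -/
def Market.domain (M : Market) : Set (ℝ × ℝ) := Ici 0 ×ˢ Icc M.lo M.hi

theorem Market.uniqueDiffOn_domain (M : Market) : UniqueDiffOn ℝ M.domain :=
  (uniqueDiffOn_Ici 0).prod (uniqueDiffOn_Icc M.lo_lt_hi)

theorem Market.hasDerivWithinAt_fst (M : Market) {f : ℝ → ℝ → ℝ}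
    (hf : DifferentiableOn ℝ (Function.uncurry f) M.domain) {z t : ℝ} (hz : 0 ≤ z)
    (ht : t ∈ Icc M.lo M.hi) :
    HasDerivWithinAt (fun x => f x t) (fderivWithin ℝ (Function.uncurry f) M.domain (z, t) (1, 0))
      (Ici 0) z := by
  have h1 := (hf (z, t) ⟨hz, ht⟩).hasFDerivWithinAt
  have h2 : HasDerivWithinAt (fun x : ℝ => (x, t)) ((1 : ℝ), (0 : ℝ)) (Ici 0) z :=
    (hasDerivWithinAt_id z _).prodMk (hasDerivWithinAt_const z _ t)
  exact h1.comp_hasDerivWithinAt z h2 (fun x hx => mk_mem_prod hx ht)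

theorem Market.hasDerivWithinAt_snd (M : Market) {f : ℝ → ℝ → ℝ}
    (hf : DifferentiableOn ℝ (Function.uncurry f) M.domain) {z t : ℝ} (hz : 0 ≤ z)
    (ht : t ∈ Icc M.lo M.hi) :
    HasDerivWithinAt (fun s => f z s) (fderivWithin ℝ (Function.uncurry f) M.domain (z, t) (0, 1))
      (Icc M.lo M.hi) t := by
  have h1 := (hf (z, t) ⟨hz, ht⟩).hasFDerivWithinAt
  have h2 : HasDerivWithinAt (fun s : ℝ => (z, s)) ((0 : ℝ), (1 : ℝ)) (Icc M.lo M.hi) t :=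
    (hasDerivWithinAt_const t _ z).prodMk (hasDerivWithinAt_id t _)
  exact h1.comp_hasDerivWithinAt t h2 (fun x hx => mk_mem_prod hz hx)

theorem Market.differentiableOn_cost (M : Market) :
    DifferentiableOn ℝ (Function.uncurry M.cost) M.domain :=
  M.smooth.differentiableOn (by norm_num)

theorem Market.continuousOn_cost (M : Market) :
    ContinuousOn (Function.uncurry M.cost) M.domain := M.smooth.continuousOn

theorem Market.costQ_eq (M : Market) {z t : ℝ} (hz : 0 ≤ z) (ht : t ∈ Icc M.lo M.hi) :
    costQ M.cost z t = fderivWithin ℝ (Function.uncurry M.cost) M.domain (z, t) (1, 0) :=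
  (M.hasDerivWithinAt_fst M.differentiableOn_cost hz ht).derivWithin (uniqueDiffOn_Ici 0 z hz)

theorem Market.costT_eq (M : Market) {z t : ℝ} (hz : 0 ≤ z) (ht : t ∈ Icc M.lo M.hi) :
    costT M.lo M.hi M.cost z t =
      fderivWithin ℝ (Function.uncurry M.cost) M.domain (z, t) (0, 1) :=
  (M.hasDerivWithinAt_snd M.differentiableOn_cost hz ht).derivWithin
    (uniqueDiffOn_Icc M.lo_lt_hi t ht)

theorem Market.contDiffOn_fderivWithin (M : Market) :
    ContDiffOn ℝ 1 (fderivWithin ℝ (Function.uncurry M.cost) M.domain) M.domain :=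
  M.smooth.fderivWithin M.uniqueDiffOn_domain (by norm_num)

theorem Market.contDiffOn_costQ (M : Market) :
    ContDiffOn ℝ 1 (Function.uncurry (costQ M.cost)) M.domain := by
  refine (M.contDiffOn_fderivWithin.clm_apply (contDiffOn_const (c := ((1 : ℝ), (0 : ℝ))))).congr ?_
  rintro ⟨z, t⟩ ⟨hz, ht⟩
  exact M.costQ_eq hz ht

theorem Market.continuousOn_costT (M : Market) :
    ContinuousOn (Function.uncurry (costT M.lo M.hi M.cost)) M.domain := by
  refine (M.contDiffOn_fderivWithin.clm_apply
    (contDiffOn_const (c := ((0 : ℝ), (1 : ℝ))))).continuousOn.congr ?_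
  rintro ⟨z, t⟩ ⟨hz, ht⟩
  exact M.costT_eq hz ht

theorem Market.hasDerivWithinAt_costQ (M : Market) {z t : ℝ} (hz : 0 ≤ z)
    (ht : t ∈ Icc M.lo M.hi) :
    HasDerivWithinAt (fun x => M.cost x t) (costQ M.cost z t) (Ici 0) z := by
  rw [M.costQ_eq hz ht]
  exact M.hasDerivWithinAt_fst M.differentiableOn_cost hz ht

theorem Market.hasDerivWithinAt_costT (M : Market) {z t : ℝ} (hz : 0 ≤ z)
    (ht : t ∈ Icc M.lo M.hi) :
    HasDerivWithinAt (fun s => M.cost z s) (costT M.lo M.hi M.cost z t) (Icc M.lo M.hi) t := by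
  rw [M.costT_eq hz ht]
  exact M.hasDerivWithinAt_snd M.differentiableOn_cost hz ht

/-- A function with nonnegative one-sided derivative on a convex set is nondecreasing. -/
theorem Convex.monotoneOn_of_hasDerivWithinAt_nonneg {f f' : ℝ → ℝ} {s : Set ℝ} (hs : Convex ℝ s)
    (hd : ∀ x ∈ s, HasDerivWithinAt f (f' x) s x) (h0 : ∀ x ∈ s, 0 ≤ f' x) : MonotoneOn f s := by
  refine monotoneOn_of_deriv_nonneg hs (fun x hx => (hd x hx).continuousWithinAt) ?_ ?_
  · intro x hx
    exact ((hd x (interior_subset hx)).mono interior_subset).differentiableWithinAt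
  · intro x hx
    rw [((hd x (interior_subset hx)).hasDerivAt (mem_interior_iff_mem_nhds.1 hx)).deriv]
    exact h0 x (interior_subset hx)

theorem Convex.antitoneOn_of_hasDerivWithinAt_nonpos {f f' : ℝ → ℝ} {s : Set ℝ} (hs : Convex ℝ s)
    (hd : ∀ x ∈ s, HasDerivWithinAt f (f' x) s x) (h0 : ∀ x ∈ s, f' x ≤ 0) : AntitoneOn f s := by
  have := Convex.monotoneOn_of_hasDerivWithinAt_nonneg (f := fun x => -f x) (f' := fun x => -f' x) hs
    (fun x hx => (hd x hx).fun_neg) (fun x hx => by have := h0 x hx; linarith)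
  intro x hx y hy hxy
  have := this hx hy hxy
  simp only at this
  linarith

theorem Market.monotoneOn_cost (M : Market) {t : ℝ} (ht : t ∈ Icc M.lo M.hi) :
    MonotoneOn (fun z => M.cost z t) (Ici 0) :=
  Convex.monotoneOn_of_hasDerivWithinAt_nonneg (convex_Ici 0)
    (fun _ hz => M.hasDerivWithinAt_costQ hz ht) (fun z hz => M.costQ_nonneg z hz t ht)

theorem Market.cost_nonneg (M : Market) {z t : ℝ} (hz : 0 ≤ z) (ht : t ∈ Icc M.lo M.hi) :
    0 ≤ M.cost z t := by
  have := M.monotoneOn_cost ht (mem_Ici.2 le_rfl) hz hz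
  simpa [M.cost_zero t ht] using this

theorem Market.antitoneOn_cost (M : Market) {z : ℝ} (hz : 0 ≤ z) :
    AntitoneOn (fun t => M.cost z t) (Icc M.lo M.hi) :=
  Convex.antitoneOn_of_hasDerivWithinAt_nonpos (convex_Icc _ _)
    (fun _ ht => M.hasDerivWithinAt_costT hz ht) (fun t ht => M.costT_nonpos z hz t ht)

theorem Market.monotoneOn_costQ (M : Market) {t : ℝ} (ht : t ∈ Icc M.lo M.hi) :
    MonotoneOn (fun z => costQ M.cost z t) (Ici 0) :=
  Convex.monotoneOn_of_hasDerivWithinAt_nonneg (convex_Ici 0)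
    (fun z hz => ((M.hasDerivWithinAt_fst (M.contDiffOn_costQ.differentiableOn (by norm_num))
      hz ht).differentiableWithinAt).hasDerivWithinAt) (fun z hz => M.costQQ_nonneg z hz t ht)

theorem Market.antitoneOn_costQ (M : Market) {z : ℝ} (hz : 0 ≤ z) :
    AntitoneOn (fun t => costQ M.cost z t) (Icc M.lo M.hi) :=
  Convex.antitoneOn_of_hasDerivWithinAt_nonpos (convex_Icc _ _)
    (fun t ht => ((M.hasDerivWithinAt_snd (M.contDiffOn_costQ.differentiableOn (by norm_num))
      hz ht).differentiableWithinAt).hasDerivWithinAt) (fun t ht => M.costQT_nonpos z hz t ht)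

/-- Costs are (weakly) submodular. -/
theorem Market.submodular (M : Market) {z z' t t' : ℝ} (hz : 0 ≤ z) (hzz : z ≤ z')
    (ht : t ∈ Icc M.lo M.hi) (ht' : t' ∈ Icc M.lo M.hi) (htt : t ≤ t') :
    M.cost z' t' - M.cost z t' ≤ M.cost z' t - M.cost z t := by
  have := Convex.monotoneOn_of_hasDerivWithinAt_nonneg (f := fun x => M.cost x t - M.cost x t')
    (convex_Ici 0)
    (fun x hx => (M.hasDerivWithinAt_costQ hx ht).fun_sub (M.hasDerivWithinAt_costQ hx ht'))
    (fun x hx => sub_nonneg.2 (M.antitoneOn_costQ hx ht ht' htt)) hz (hz.trans hzz : (0 : ℝ) ≤ z')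
    hzz
  simp only at this
  linarith

theorem Market.exists_costQ_eq_slope (M : Market) {a b t : ℝ} (ha : 0 ≤ a) (hab : a < b)
    (ht : t ∈ Icc M.lo M.hi) :
    ∃ x ∈ Ioo a b, M.cost b t - M.cost a t = (b - a) * costQ M.cost x t := by
  obtain ⟨x, hx, h⟩ := exists_hasDerivAt_eq_slope (fun x => M.cost x t)
    (fun x => costQ M.cost x t) hab
    (fun x hx => ((M.hasDerivWithinAt_costQ (ha.trans hx.1) ht).mono
      (fun y hy => ha.trans hy.1)).continuousWithinAt)
    (fun x hx => (M.hasDerivWithinAt_costQ (ha.trans hx.1.le) ht).hasDerivAt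
      (Ici_mem_nhds (ha.trans_lt hx.1)))
  refine ⟨x, hx, ?_⟩
  rw [h]
  field_simp [(sub_pos.2 hab).ne']

theorem Market.cost_sub_le (M : Market) {a b t : ℝ} (ha : 0 ≤ a) (hab : a ≤ b)
    (ht : t ∈ Icc M.lo M.hi) : M.cost b t - M.cost a t ≤ (b - a) * costQ M.cost b t := by
  rcases hab.eq_or_lt with rfl | hab
  · simp
  obtain ⟨x, hx, h⟩ := M.exists_costQ_eq_slope ha hab ht
  rw [h]
  exact mul_le_mul_of_nonneg_left (M.monotoneOn_costQ ht (ha.trans hx.1.le)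
    (ha.trans hab.le) hx.2.le) (sub_nonneg.2 hab.le)

theorem Market.le_cost_sub (M : Market) {a b t : ℝ} (ha : 0 ≤ a) (hab : a ≤ b)
    (ht : t ∈ Icc M.lo M.hi) : (b - a) * costQ M.cost a t ≤ M.cost b t - M.cost a t := by
  rcases hab.eq_or_lt with rfl | hab
  · simp
  obtain ⟨x, hx, h⟩ := M.exists_costQ_eq_slope ha hab ht
  rw [h]
  exact mul_le_mul_of_nonneg_left (M.monotoneOn_costQ ht ha (ha.trans hx.1.le) hx.1.le)
    (sub_nonneg.2 hab.le)

/-- Marginal costs of bounded qualities are uniformly continuous in the type. -/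
theorem Market.exists_costQ_sub_le (M : Market) (B : ℝ) {ε : ℝ} (hε : 0 < ε) :
    ∃ δ > 0, ∀ z ∈ Icc 0 B, ∀ s ∈ Icc M.lo M.hi, ∀ t ∈ Icc M.lo M.hi, |t - s| < δ →
      costQ M.cost z s - costQ M.cost z t ≤ ε := by
  have hc : IsCompact (Icc 0 B ×ˢ Icc M.lo M.hi) := isCompact_Icc.prod isCompact_Icc
  have hu := hc.uniformContinuousOn_of_continuous
    (M.contDiffOn_costQ.continuousOn.mono (prod_mono Icc_subset_Ici_self Subset.rfl))
  rw [Metric.uniformContinuousOn_iff] at hu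
  obtain ⟨δ, hδ, h⟩ := hu ε hε
  refine ⟨δ, hδ, fun z hz s hs t ht hst => ?_⟩
  have := h (z, s) ⟨hz, hs⟩ (z, t) ⟨hz, ht⟩ (by
    rw [Prod.dist_eq]; simpa [Real.dist_eq, abs_sub_comm s t] using hst)
  rw [Real.dist_eq] at this
  exact (le_abs_self _).trans this.le

/-- `-C_θ` is nondecreasing in quality. -/
theorem Market.antitoneOn_costT (M : Market) {t : ℝ} (ht : t ∈ Icc M.lo M.hi) :
    AntitoneOn (fun z => costT M.lo M.hi M.cost z t) (Ici 0) := by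
  intro z hz z' hz' hzz
  have hd := (M.hasDerivWithinAt_costT hz' ht).fun_sub (M.hasDerivWithinAt_costT hz ht)
  have hanti : AntitoneOn (fun s => M.cost z' s - M.cost z s) (Icc M.lo M.hi) :=
    fun s hs s' hs' hss => M.submodular hz hzz hs hs' hss
  have := hd.derivWithin (uniqueDiffOn_Icc M.lo_lt_hi t ht)
  have h2 := hanti.derivWithin_nonpos (x := t)
  rw [this] at h2
  simp only
  linarith

theorem Market.continuousOn_costT_snd (M : Market) {z : ℝ} (hz : 0 ≤ z) :
    ContinuousOn (fun t => costT M.lo M.hi M.cost z t) (Icc M.lo M.hi) :=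
  M.continuousOn_costT.comp (f := fun t => (z, t)) (by fun_prop) (fun t ht => ⟨hz, ht⟩)

theorem Market.continuousOn_cost_snd (M : Market) {z : ℝ} (hz : 0 ≤ z) :
    ContinuousOn (fun t => M.cost z t) (Icc M.lo M.hi) :=
  M.continuousOn_cost.comp (f := fun t => (z, t)) (by fun_prop) (fun t ht => ⟨hz, ht⟩)

theorem Market.integral_costT (M : Market) {z s t : ℝ} (hz : 0 ≤ z) (hs : s ∈ Icc M.lo M.hi)
    (ht : t ∈ Icc M.lo M.hi) (hst : s ≤ t) :
    ∫ u in s..t, costT M.lo M.hi M.cost z u = M.cost z t - M.cost z s := by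
  have hsub : Icc s t ⊆ Icc M.lo M.hi := Icc_subset_Icc hs.1 ht.2
  refine intervalIntegral.integral_eq_sub_of_hasDerivAt_of_le hst
    ((M.continuousOn_cost_snd hz).mono hsub) (fun u hu => ?_) ?_
  · exact (M.hasDerivWithinAt_costT hz (hsub (Ioo_subset_Icc_self hu))).hasDerivAt
      (Icc_mem_nhds (hs.1.trans_lt hu.1) (hu.2.trans_le ht.2))
  · refine ContinuousOn.intervalIntegrable ?_
    rw [uIcc_of_le hst]
    exact (M.continuousOn_costT_snd hz).mono hsub

/-- If the short increments of `D` are eventually small compared with those of `m`, then `D` does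
not increase. -/
theorem le_of_forall_short_increment_le {D m : ℝ → ℝ} {a b : ℝ} (hab : a ≤ b)
    (h : ∀ ε > 0, ∃ δ > 0, ∀ s ∈ Icc a b, ∀ t ∈ Icc a b, s ≤ t → t - s < δ →
      D t - D s ≤ ε * (m t - m s)) : D b ≤ D a := by
  have key : ∀ ε > 0, D b - D a ≤ ε * (m b - m a) := by
    intro ε hε
    obtain ⟨δ, hδ, hd⟩ := h ε hε
    obtain ⟨n, hn⟩ := exists_nat_gt ((b - a) / δ)
    have hn0 : (0 : ℝ) < n := (div_nonneg (sub_nonneg.2 hab) hδ.le).trans_lt hn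
    set x : ℕ → ℝ := fun i => a + i * ((b - a) / n) with hx
    have hstep : 0 ≤ (b - a) / n := div_nonneg (sub_nonneg.2 hab) hn0.le
    have hx0 : x 0 = a := by simp [hx]
    have hxn : x n = b := by simp only [hx]; field_simp; ring
    have hmem : ∀ i ≤ n, x i ∈ Icc a b := by
      intro i hi
      refine ⟨by simp only [hx]; nlinarith [(Nat.cast_nonneg i : (0 : ℝ) ≤ i)], ?_⟩
      rw [← hxn]
      simp only [hx]
      have : (i : ℝ) ≤ n := by exact_mod_cast hi
      nlinarith
    have h1 : D b - D a = ∑ i ∈ Finset.range n, (D (x (i + 1)) - D (x i)) := by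
      rw [Finset.sum_range_sub (fun i => D (x i)), hx0, hxn]
    have h2 : m b - m a = ∑ i ∈ Finset.range n, (m (x (i + 1)) - m (x i)) := by
      rw [Finset.sum_range_sub (fun i => m (x i)), hx0, hxn]
    rw [h1, h2, Finset.mul_sum]
    refine Finset.sum_le_sum fun i hi => ?_
    have hi := Finset.mem_range.1 hi
    have hdiff : x (i + 1) - x i = (b - a) / n := by simp only [hx]; push_cast; ring
    refine hd _ (hmem i hi.le) _ (hmem (i + 1) hi) (by linarith) ?_
    rw [hdiff, div_lt_iff₀ hn0]
    rw [div_lt_iff₀ hδ] at hn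
    linarith
  refine le_of_forall_pos_le_add fun ε hε => ?_
  have h1 := key (ε / (|m b - m a| + 1)) (by positivity)
  have h2 : ε / (|m b - m a| + 1) * (m b - m a) ≤ ε := by
    rw [div_mul_eq_mul_div, div_le_iff₀ (by positivity)]
    nlinarith [le_abs_self (m b - m a)]
  linarith

theorem Market.cost_sub_sub_le (M : Market) {z z' s t ε : ℝ} (hz : 0 ≤ z) (hzz : z ≤ z')
    (hs : s ∈ Icc M.lo M.hi) (ht : t ∈ Icc M.lo M.hi)
    (h : ∀ x ∈ Icc z z', costQ M.cost x s - costQ M.cost x t ≤ ε) :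
    (M.cost z' s - M.cost z s) - (M.cost z' t - M.cost z t) ≤ ε * (z' - z) := by
  have hsub : Icc z z' ⊆ Ici 0 := fun x hx => hz.trans hx.1
  have := Convex.monotoneOn_of_hasDerivWithinAt_nonneg
    (f := fun x => ε * x - (M.cost x s - M.cost x t)) (convex_Icc z z')
    (f' := fun x => ε * 1 - (costQ M.cost x s - costQ M.cost x t))
    (fun x hx => ((hasDerivWithinAt_id x _).const_mul ε).fun_sub
      (((M.hasDerivWithinAt_costQ (hsub hx) hs).mono hsub).fun_sub
        ((M.hasDerivWithinAt_costQ (hsub hx) ht).mono hsub)))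
    (fun x hx => by have := h x hx; linarith) ⟨le_rfl, hzz⟩ ⟨hzz, le_rfl⟩ hzz
  simp only at this
  linarith

/-- A direct mechanism for the types in `[c, hi]`: nondecreasing qualities `q` and profits `P` such
that no type gains by choosing the quality of another type. -/
structure Market.IsContract (M : Market) (c : ℝ) (q P : ℝ → ℝ) : Prop where
  quality_nonneg : ∀ t ∈ Icc c M.hi, 0 ≤ q t
  monotone_quality : MonotoneOn q (Icc c M.hi)
  incentive : ∀ s ∈ Icc c M.hi, ∀ t ∈ Icc c M.hi,
    P s + M.cost (q s) s - M.cost (q s) t ≤ P t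

namespace Market.IsContract

variable {M : Market} {c : ℝ} {q P q' P' : ℝ → ℝ}

theorem monotone_profit (h : M.IsContract c q P) (hc : M.lo ≤ c) :
    MonotoneOn P (Icc c M.hi) := by
  intro s hs t ht hst
  have h1 := h.incentive s hs t ht
  have h2 := M.antitoneOn_cost (h.quality_nonneg s hs) ⟨hc.trans hs.1, hs.2⟩
    ⟨hc.trans ht.1, ht.2⟩ hst
  simp only at h2
  linarith

theorem monotone_signaled (h : M.IsContract c q P) (hc : M.lo ≤ c) :
    MonotoneOn (fun t => P t + M.cost (q t) t) (Icc c M.hi) := by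
  intro s hs t ht hst
  have h1 := h.incentive t ht s hs
  have h2 := h.incentive s hs t ht
  have h3 := M.monotoneOn_cost ⟨hc.trans ht.1, ht.2⟩ (h.quality_nonneg s hs)
    (h.quality_nonneg t ht) (h.monotone_quality hs ht hst)
  simp only at h3 ⊢
  linarith

/-- Lower qualities mean smaller information rents. -/
theorem antitone_profit_sub (h : M.IsContract c q P) (h' : M.IsContract c q' P')
    (hc : M.lo ≤ c) (hle : ∀ t ∈ Icc c M.hi, q' t ≤ q t) :
    AntitoneOn (fun t => P' t - P t) (Icc c M.hi) := by
  intro a ha b hb hab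
  refine le_of_forall_short_increment_le (D := fun t => P' t - P t) (m := q') hab ?_
  intro ε hε
  obtain ⟨δ, hδ, hd⟩ := M.exists_costQ_sub_le (q' M.hi) hε
  refine ⟨δ, hδ, fun s hs t ht hst hlt => ?_⟩
  have hs' : s ∈ Icc c M.hi := ⟨ha.1.trans hs.1, hs.2.trans hb.2⟩
  have ht' : t ∈ Icc c M.hi := ⟨ha.1.trans ht.1, ht.2.trans hb.2⟩
  have hsL : s ∈ Icc M.lo M.hi := ⟨hc.trans hs'.1, hs'.2⟩
  have htL : t ∈ Icc M.lo M.hi := ⟨hc.trans ht'.1, ht'.2⟩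
  have hhi : M.hi ∈ Icc c M.hi := ⟨ha.1.trans ha.2, le_rfl⟩
  have h1 := h.incentive s hs' t ht'
  have h2 := h'.incentive t ht' s hs'
  have h3 := M.submodular (h'.quality_nonneg s hs') (hle s hs') hsL htL hst
  have hqs := h'.quality_nonneg s hs'
  have hm := h'.monotone_quality hs' ht' hst
  have h4 := M.cost_sub_sub_le hqs hm hsL htL (ε := ε) fun x hx =>
    hd x ⟨hqs.trans hx.1, hx.2.trans (h'.monotone_quality ht' hhi ht'.2)⟩ s hsL t htL
      (by rwa [abs_of_nonneg (sub_nonneg.2 hst)])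
  linarith

/-- If the marginal costs at the chosen qualities do not exceed `1`, then signaled quality rises at
most as fast as quality. -/
theorem antitone_signaled_sub (h : M.IsContract c q P) (hc : M.lo ≤ c)
    (hle : ∀ t ∈ Ico c M.hi, costQ M.cost (q t) t ≤ 1) :
    AntitoneOn (fun t => P t + M.cost (q t) t - q t) (Ico c M.hi) := by
  intro a ha b hb hab
  refine le_of_forall_short_increment_le (D := fun t => P t + M.cost (q t) t - q t) (m := q) hab ?_
  intro ε hε
  obtain ⟨δ, hδ, hd⟩ := M.exists_costQ_sub_le (q M.hi) hε
  refine ⟨δ, hδ, fun s hs t ht hst hlt => ?_⟩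
  have hs' : s ∈ Icc c M.hi := ⟨ha.1.trans hs.1, hs.2.trans hb.2.le⟩
  have ht' : t ∈ Icc c M.hi := ⟨ha.1.trans ht.1, ht.2.trans hb.2.le⟩
  have hsL : s ∈ Icc M.lo M.hi := ⟨hc.trans hs'.1, hs'.2⟩
  have htL : t ∈ Icc M.lo M.hi := ⟨hc.trans ht'.1, ht'.2⟩
  have hhi : M.hi ∈ Icc c M.hi := ⟨hs'.1.trans hs'.2, le_rfl⟩
  have h1 := h.incentive t ht' s hs'
  have hm := h.monotone_quality hs' ht' hst
  have h2 := M.cost_sub_le (h.quality_nonneg s hs') hm hsL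
  have h3 := hd (q t) ⟨h.quality_nonneg t ht', h.monotone_quality ht' hhi ht'.2⟩ s hsL t htL
    (by rwa [abs_of_nonneg (sub_nonneg.2 hst)])
  have h4 := hle t ⟨ht'.1, ht.2.trans_lt hb.2⟩
  have h5 : (q t - q s) * costQ M.cost (q t) s ≤ (q t - q s) * (1 + ε) :=
    mul_le_mul_of_nonneg_left (by linarith) (sub_nonneg.2 hm)
  linarith

end Market.IsContract

/-- The type in `[c, d]` closest to `t`. -/
def clamp (c d t : ℝ) : ℝ := max c (min d t)

theorem clamp_mem {c d : ℝ} (h : c ≤ d) (t : ℝ) : clamp c d t ∈ Icc c d :=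
  ⟨le_max_left _ _, max_le h (min_le_left _ _)⟩

theorem clamp_of_mem {c d t : ℝ} (h : t ∈ Icc c d) : clamp c d t = t := by
  rw [clamp, min_eq_right h.2, max_eq_right h.1]

theorem monotone_clamp (c d : ℝ) : Monotone (clamp c d) :=
  fun _ _ h => max_le_max le_rfl (min_le_min le_rfl h)

theorem MonotoneOn.comp_clamp {c d : ℝ} {f : ℝ → ℝ} (hf : MonotoneOn f (Icc c d)) (h : c ≤ d) :
    Monotone fun t => f (clamp c d t) :=
  fun s t hst => hf (clamp_mem h s) (clamp_mem h t) (monotone_clamp c d hst)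

theorem Market.integrableOn_costT (M : Market) {c : ℝ} (hc : c ∈ Icc M.lo M.hi) {q : ℝ → ℝ}
    (hq0 : ∀ t ∈ Icc c M.hi, 0 ≤ q t) (hq : MonotoneOn q (Icc c M.hi)) :
    IntegrableOn (fun u => costT M.lo M.hi M.cost (q u) u) (Icc c M.hi) := by
  classical
  have hsub : Icc c M.hi ⊆ Icc M.lo M.hi := Icc_subset_Icc_left hc.1
  have hhi : M.hi ∈ Icc c M.hi := ⟨hc.2, le_rfl⟩
  have hD : MeasurableSet M.domain := measurableSet_Ici.prod measurableSet_Icc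
  have hG := M.continuousOn_costT.measurable_piecewise
    (continuousOn_const (c := (0 : ℝ)) (s := M.domainᶜ)) hD
  have hm := (hG.comp ((hq.comp_clamp hc.2).measurable.prodMk
    (monotone_clamp c M.hi).measurable)).aestronglyMeasurable (μ := volume.restrict (Icc c M.hi))
  have hdom : IntegrableOn (fun u => costT M.lo M.hi M.cost (q M.hi) u) (Icc c M.hi) :=
    ((M.continuousOn_costT_snd (hq0 _ hhi)).mono hsub).integrableOn_Icc
  refine Integrable.mono hdom (hm.congr ?_) ?_
  · filter_upwards [ae_restrict_mem measurableSet_Icc] with u hu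
    have hmem : (q u, u) ∈ M.domain := ⟨hq0 u hu, hsub hu⟩
    rw [Function.comp_apply, clamp_of_mem hu]
    exact piecewise_eq_of_mem _ _ _ hmem
  · filter_upwards [ae_restrict_mem measurableSet_Icc] with u hu
    rw [Real.norm_of_nonpos (M.costT_nonpos _ (hq0 u hu) u (hsub hu)),
      Real.norm_of_nonpos (M.costT_nonpos _ (hq0 _ hhi) u (hsub hu)), neg_le_neg_iff]
    exact M.antitoneOn_costT (hsub hu) (hq0 u hu) (hq0 _ hhi) (hq hu hhi hu.2)

/-- Nondecreasing qualities are incentive compatible for suitable profits, with any profit for the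
lowest type. -/
theorem Market.exists_isContract (M : Market) {c : ℝ} (hc : c ∈ Icc M.lo M.hi) {q : ℝ → ℝ}
    (hq0 : ∀ t ∈ Icc c M.hi, 0 ≤ q t) (hq : MonotoneOn q (Icc c M.hi)) (p : ℝ) :
    ∃ P, M.IsContract c q P ∧ P c = p := by
  have hsub : Icc c M.hi ⊆ Icc M.lo M.hi := Icc_subset_Icc_left hc.1
  have hcc : c ∈ Icc c M.hi := ⟨le_rfl, hc.2⟩
  have hint : ∀ s ∈ Icc c M.hi, ∀ t ∈ Icc c M.hi,
      IntervalIntegrable (fun u => costT M.lo M.hi M.cost (q u) u) volume s t := by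
    intro s hs t ht
    exact ((M.integrableOn_costT hc hq0 hq).mono_set
      (uIcc_subset_Icc hs ht)).intervalIntegrable
  have hint' : ∀ z, 0 ≤ z → ∀ s ∈ Icc c M.hi, ∀ t ∈ Icc c M.hi,
      IntervalIntegrable (fun u => costT M.lo M.hi M.cost z u) volume s t := by
    intro z hz s hs t ht
    exact ((M.continuousOn_costT_snd hz).mono ((uIcc_subset_Icc hs ht).trans hsub)).intervalIntegrable
  refine ⟨fun t => p - ∫ u in c..t, costT M.lo M.hi M.cost (q u) u, ⟨hq0, hq, ?_⟩, by simp⟩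
  intro s hs t ht
  have hadd := intervalIntegral.integral_add_adjacent_intervals (hint c hcc s hs) (hint s hs t ht)
  have hqs := hq0 s hs
  rcases le_total s t with hst | hts
  · have h1 := M.integral_costT hqs (hsub hs) (hsub ht) hst
    have h2 := intervalIntegral.integral_mono_on hst (hint s hs t ht) (hint' _ hqs s hs t ht)
      fun u hu => by
        have hu' : u ∈ Icc c M.hi := ⟨hs.1.trans hu.1, hu.2.trans ht.2⟩
        exact M.antitoneOn_costT (hsub hu') hqs (hq0 u hu') (hq hs hu' hu.1)
    linarith
  · have h1 := M.integral_costT hqs (hsub ht) (hsub hs) hts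
    have h2 := intervalIntegral.integral_mono_on hts (hint' _ hqs t ht s hs) (hint t ht s hs)
      fun u hu => by
        have hu' : u ∈ Icc c M.hi := ⟨ht.1.trans hu.1, hu.2.trans hs.2⟩
        exact M.antitoneOn_costT (hsub hu') (hq0 u hu') hqs (hq hu' hs hu.2)
    rw [intervalIntegral.integral_symm t s] at hadd
    linarith

noncomputable section

instance RatedMarket.isFiniteMeasure_joint (A : RatedMarket) (M : Market) (c : ℝ) :
    IsFiniteMeasure (A.joint M c) := by
  unfold RatedMarket.joint
  infer_instance

theorem integrable_integral_compProd {α β : Type*} [MeasurableSpace α] [MeasurableSpace β]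
    {μ : Measure α} [SFinite μ] {κ : Kernel α β} [IsSFiniteKernel κ] {f : α × β → ℝ}
    (hf : Integrable f (μ ⊗ₘ κ)) : Integrable (fun a => ∫ b, f (a, b) ∂(κ a)) μ := by
  unfold Measure.compProd at hf
  simpa using hf.integral_compProd

theorem RatedMarket.integrable_quality_joint {A : RatedMarket} {M : Market} {c : ℝ}
    (h : IntegrableOn (fun θ => (A.quality θ : ℝ)) (Icc c M.hi) M.F) :
    Integrable (fun w : ℝ × A.S => (A.quality w.1 : ℝ)) (A.joint M c) := by
  have := A.measurable_quality
  unfold RatedMarket.joint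
  have hm : Measurable fun w : ℝ × A.S => (A.quality w.1 : ℝ) :=
    (this.comp measurable_fst).coe_nnreal_real
  rw [Measure.integrable_compProd_iff hm.aestronglyMeasurable]
  exact ⟨by simp, by simpa using h.integrable⟩

/-- Signaled quality equals quality on average. -/
theorem IsEquilibrium.integral_signaled {M : Market} {c : ℝ} {A : RatedMarket}
    (h : IsEquilibrium M c A) :
    IntegrableOn A.signaled (Icc c M.hi) M.F ∧
      ∫ θ in Icc c M.hi, A.signaled θ ∂M.F = ∫ θ in Icc c M.hi, (A.quality θ : ℝ) ∂M.F := by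
  have hm : MeasurableSpace.comap Prod.snd A.mS ≤ (inferInstance : MeasurableSpace (ℝ × A.S)) :=
    measurable_snd.comap_le
  have hq := RatedMarket.integrable_quality_joint h.integrable_quality
  have hp : Integrable (fun w : ℝ × A.S => (A.price w.2 : ℝ)) (A.joint M c) :=
    integrable_condExp.congr h.price_eq.symm
  have h1 : ∫ w, (A.price w.2 : ℝ) ∂(A.joint M c) = ∫ w, (A.quality w.1 : ℝ) ∂(A.joint M c) := by
    rw [integral_congr_ae h.price_eq, integral_condExp hm]
  unfold RatedMarket.joint at h1 hp hq
  rw [Measure.integral_compProd hp, Measure.integral_compProd hq] at h1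
  have h2 := integrable_integral_compProd hp
  simp only [Kernel.comap_apply, integral_const, probReal_univ, one_smul] at h1 h2
  exact ⟨h2, h1⟩

/-- The probability of revealing quality `z` that yields the signaled quality `g z` when the
generic signal has price `x`. -/
def revealProb (g : ℝ≥0 → ℝ≥0) (x z : ℝ≥0) : ℝ := ((g z : ℝ) - x) / (z - x)

theorem revealProb_mem_Icc {g : ℝ≥0 → ℝ≥0} {x z : ℝ≥0} (h : (g z : ℝ) ∈ uIcc (z : ℝ) x) :
    revealProb g x z ∈ Icc (0 : ℝ) 1 := by
  unfold revealProb
  rcases lt_trichotomy (z : ℝ) x with hz | hz | hz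
  · rw [uIcc_of_le hz.le] at h
    exact ⟨div_nonneg_of_nonpos (by linarith [h.2]) (by linarith),
      (div_le_one_of_neg (by linarith)).2 (by linarith [h.1])⟩
  · simp [hz]
  · rw [uIcc_of_ge hz.le] at h
    exact ⟨div_nonneg (by linarith [h.1]) (by linarith),
      (div_le_one (by linarith)).2 (by linarith [h.2])⟩

theorem revealProb_lt_one {g : ℝ≥0 → ℝ≥0} {x z : ℝ≥0} (h : (g z : ℝ) ∈ uIcc (z : ℝ) x)
    (hne : (g z : ℝ) = z → (z : ℝ) = x) : revealProb g x z < 1 := by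
  refine lt_of_le_of_ne (revealProb_mem_Icc h).2 fun h1 => ?_
  rcases eq_or_ne (z : ℝ) x with hz | hz
  · simp [revealProb, hz] at h1
  · unfold revealProb at h1
    rw [div_eq_one_iff_eq (sub_ne_zero.2 hz)] at h1
    exact hz (hne (by linarith))

theorem revealProb_spec {g : ℝ≥0 → ℝ≥0} {x z : ℝ≥0} (h : (g z : ℝ) ∈ uIcc (z : ℝ) x) :
    (g z : ℝ) = revealProb g x z * z + (1 - revealProb g x z) * x := by
  rcases eq_or_ne (z : ℝ) x with hz | hz
  · rw [hz] at h
    simp only [uIcc_self, mem_singleton_iff] at h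
    rw [h, hz]
    ring
  · have := sub_ne_zero.2 hz
    unfold revealProb
    field_simp
    ring

theorem integral_two_dirac {S : Type*} [MeasurableSpace S] [MeasurableSingletonClass S] (f : S → ℝ)
    {a b : ℝ} (ha : 0 ≤ a) (hb : 0 ≤ b) (u v : S) :
    ∫ s, f s ∂(ENNReal.ofReal a • Measure.dirac u + ENNReal.ofReal b • Measure.dirac v) =
      a * f u + b * f v := by
  have hi : ∀ w : S, Integrable f (Measure.dirac w) := fun w => integrable_dirac (by finiteness)
  rw [integral_add_measure ((hi u).smul_measure ENNReal.ofReal_ne_top)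
    ((hi v).smul_measure ENNReal.ofReal_ne_top), integral_smul_measure, integral_smul_measure,
    integral_dirac, integral_dirac, ENNReal.toReal_ofReal ha, ENNReal.toReal_ofReal hb]
  rfl

/-- The signal distribution of the mixing rating: a quality whose signaled quality `g z` lies
between `z` and `x` is revealed by `(0, z)` or pooled in `(1, x)`; any other quality `z` sends the
signal `(2, g z)`. -/
def mixingMeasure (g : ℝ≥0 → ℝ≥0) (x z : ℝ≥0) : Measure (ℕ × ℝ≥0) :=
  open Classical in
  if (g z : ℝ) ∈ uIcc (z : ℝ) x then
    ENNReal.ofReal (revealProb g x z) • Measure.dirac (0, z) +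
      ENNReal.ofReal (1 - revealProb g x z) • Measure.dirac (1, x)
  else Measure.dirac (2, g z)

theorem measurable_mixingMeasure {g : ℝ≥0 → ℝ≥0} (hg : Measurable g) (x : ℝ≥0) :
    Measurable (mixingMeasure g x) := by
  have hα : Measurable (revealProb g x) := by unfold revealProb; fun_prop
  have hd : ∀ {f : ℝ≥0 → ℕ × ℝ≥0}, Measurable f → Measurable fun z => Measure.dirac (f z) :=
    fun hf => Measure.measurable_dirac.comp hf
  unfold mixingMeasure
  refine Measurable.ite ?_ ?_ (hd (by fun_prop))
  · have h1 : Measurable fun z : ℝ≥0 => min (z : ℝ) x := by fun_prop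
    have h2 : Measurable fun z : ℝ≥0 => max (z : ℝ) x := by fun_prop
    exact (measurableSet_le h1 (by fun_prop : Measurable fun z => (g z : ℝ))).inter
      (measurableSet_le (by fun_prop : Measurable fun z => (g z : ℝ)) h2)
  · refine Measure.measurable_of_measurable_coe _ fun B hB => ?_
    have h1 : Measurable fun z : ℝ≥0 => Measure.dirac ((0 : ℕ), z) B :=
      (Measure.measurable_coe hB).comp (hd (by fun_prop))
    simp only [Measure.coe_add, Measure.coe_smul, Pi.add_apply, Pi.smul_apply, smul_eq_mul]
    fun_prop

theorem integral_mixingMeasure (g : ℝ≥0 → ℝ≥0) (x z : ℝ≥0) :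
    ∫ s, (s.2 : ℝ) ∂(mixingMeasure g x z) = g z := by
  unfold mixingMeasure
  split_ifs with h
  · rw [integral_two_dirac _ (revealProb_mem_Icc h).1 (sub_nonneg.2 (revealProb_mem_Icc h).2)]
    exact (revealProb_spec h).symm
  · rw [integral_dirac]

instance isProbabilityMeasure_mixingMeasure (g : ℝ≥0 → ℝ≥0) (x z : ℝ≥0) :
    IsProbabilityMeasure (mixingMeasure g x z) := by
  refine ⟨?_⟩
  unfold mixingMeasure
  split_ifs with h
  · have h1 := revealProb_mem_Icc h
    simp only [Measure.coe_add, Measure.coe_smul, Pi.add_apply, Pi.smul_apply, smul_eq_mul,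
      measure_univ, mul_one]
    rw [← ENNReal.ofReal_add h1.1 (sub_nonneg.2 h1.2)]
    simp
  · simp

theorem integrable_mixingMeasure (g : ℝ≥0 → ℝ≥0) (x z : ℝ≥0) (f : ℕ × ℝ≥0 → ℝ) :
    Integrable f (mixingMeasure g x z) := by
  have hi : ∀ w : ℕ × ℝ≥0, Integrable f (Measure.dirac w) := fun w =>
    integrable_dirac (by finiteness)
  unfold mixingMeasure
  split_ifs with h
  · exact ((hi _).smul_measure ENNReal.ofReal_ne_top).add_measure
      ((hi _).smul_measure ENNReal.ofReal_ne_top)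
  · exact hi _

/-- The mixing rating with signaled qualities `g` and generic price `x`. -/
def mixingMarket {g : ℝ≥0 → ℝ≥0} {q : ℝ → ℝ≥0} (hg : Measurable g) (hq : Measurable q)
    (x : ℝ≥0) : RatedMarket where
  S := ℕ × ℝ≥0
  mS := inferInstance
  rating := ⟨mixingMeasure g x, measurable_mixingMeasure hg x⟩
  markov := ⟨fun z => isProbabilityMeasure_mixingMeasure g x z⟩
  quality := q
  measurable_quality := hq
  price := Prod.snd
  measurable_price := measurable_snd

section mixingMarket

variable {M : Market} {c : ℝ} {g : ℝ≥0 → ℝ≥0} {q : ℝ → ℝ≥0} (hg : Measurable g) (hq : Measurable q)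
  (x : ℝ≥0)

@[simp]
theorem expectedPrice_mixingMarket (z : ℝ≥0) : (mixingMarket hg hq x).expectedPrice z = g z :=
  integral_mixingMeasure g x z

theorem setIntegral_mixingMeasure {x z : ℝ≥0} (h : (g z : ℝ) ∈ uIcc (z : ℝ) x)
    {B : Set (ℕ × ℝ≥0)} (hB : MeasurableSet B) :
    ∫ s in B, (s.2 : ℝ) ∂(mixingMeasure g x z) =
      ∫ _ in B, (z : ℝ) ∂(mixingMeasure g x z) + B.indicator 1 ((1 : ℕ), x) * ((g z : ℝ) - z) := by
  rw [← integral_indicator hB, ← integral_indicator hB]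
  have h0 := (revealProb_mem_Icc h).1
  have h1 := sub_nonneg.2 (revealProb_mem_Icc h).2
  have h2 := revealProb_spec h
  simp only [mixingMeasure, if_pos h, integral_two_dirac _ h0 h1]
  rw [h2]
  by_cases ha : ((0 : ℕ), z) ∈ B <;> by_cases hb : ((1 : ℕ), x) ∈ B <;> simp [ha, hb] <;> ring

theorem isEquilibrium_mixingMarket (hc : c ∈ Icc M.lo M.hi)
    (hqi : IntegrableOn (fun θ => (q θ : ℝ)) (Icc c M.hi) M.F)
    (hgi : IntegrableOn (fun θ => (g (q θ) : ℝ)) (Icc c M.hi) M.F)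
    (heq : ∫ θ in Icc c M.hi, (g (q θ) : ℝ) ∂M.F = ∫ θ in Icc c M.hi, (q θ : ℝ) ∂M.F)
    (hic : ∀ θ ∈ Icc c M.hi, ∀ z : ℝ≥0, (g z : ℝ) - M.cost z θ ≤ g (q θ) - M.cost (q θ) θ)
    (hx : ∀ θ ∈ Ico c M.hi, (g (q θ) : ℝ) ∈ uIcc (q θ : ℝ) x) :
    IsEquilibrium M c (mixingMarket hg hq x) := by
  set A := mixingMarket hg hq x with hA
  refine ⟨hc, hqi, fun z => integrable_mixingMeasure g x z _, ?_, ?_, ?_⟩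
  · have hm : MeasurableSpace.comap Prod.snd A.mS ≤ (inferInstance : MeasurableSpace (ℝ × A.S)) :=
      measurable_snd.comap_le
    have hpm : Measurable fun w : ℝ × A.S => (A.price w.2 : ℝ) :=
      (A.measurable_price.comp measurable_snd).coe_nnreal_real
    have hp : Integrable (fun w : ℝ × A.S => (A.price w.2 : ℝ)) (A.joint M c) := by
      unfold RatedMarket.joint
      rw [Measure.integrable_compProd_iff hpm.aestronglyMeasurable]
      refine ⟨ae_of_all _ fun θ => integrable_mixingMeasure g x (q θ) _, ?_⟩
      refine Integrable.congr hgi (ae_of_all _ fun θ => ?_)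
      simp only [Real.norm_of_nonneg (NNReal.coe_nonneg _)]
      exact (integral_mixingMeasure g x (q θ)).symm
    have hqj := RatedMarket.integrable_quality_joint (A := A) (M := M) (c := c) hqi
    refine ae_eq_condExp_of_forall_setIntegral_eq hm hqj (fun _ _ _ => hp.integrableOn) ?_ ?_
    · rintro _ ⟨B, hB, rfl⟩ -
      rw [← univ_prod]
      unfold RatedMarket.joint at hp hqj ⊢
      rw [Measure.setIntegral_compProd MeasurableSet.univ hB hp.integrableOn,
        Measure.setIntegral_compProd MeasurableSet.univ hB hqj.integrableOn]
      simp only [Measure.restrict_univ]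
      have h1 : ∀ᵐ θ ∂(M.F.restrict (Icc c M.hi)),
          ∫ s in B, (A.price s : ℝ) ∂(A.rating.comap A.quality A.measurable_quality θ) =
          ∫ _ in B, (A.quality θ : ℝ) ∂(A.rating.comap A.quality A.measurable_quality θ) +
            B.indicator 1 ((1 : ℕ), x) * ((g (q θ) : ℝ) - q θ) := by
        have hne : ∀ᵐ θ ∂M.F, θ ≠ M.hi := by simp [ae_iff]
        filter_upwards [ae_restrict_mem measurableSet_Icc, ae_restrict_of_ae hne] with θ hθ hθ'
        exact setIntegral_mixingMeasure (hx θ ⟨hθ.1, lt_of_le_of_ne hθ.2 hθ'⟩) hB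
      rw [integral_congr_ae h1, integral_add, integral_const_mul, integral_sub hgi hqi, heq]
      · simp
      · have := integrable_integral_compProd (hqj.indicator (measurable_snd hB))
        refine this.congr (ae_of_all _ fun θ => ?_)
        exact integral_indicator hB
      · exact (Integrable.sub hgi hqi).const_mul _
    · refine Measurable.aestronglyMeasurable ?_
      have h1 : Measurable[MeasurableSpace.comap Prod.snd A.mS] (Prod.snd : ℝ × A.S → A.S) :=
        comap_measurable _
      exact (A.measurable_price.comp h1).coe_nnreal_real
  · intro θ hθ z
    simp only [RatedMarket.profit, RatedMarket.payoff, hA, expectedPrice_mixingMarket]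
    exact hic θ hθ z
  · intro θ hθ
    have h0 := hic θ hθ 0
    rw [NNReal.coe_zero, M.cost_zero θ ⟨hc.1.trans hθ.1, hθ.2⟩] at h0
    have h1 := (g 0).coe_nonneg
    have h2 : A.profit M θ = g (q θ) - M.cost (q θ) θ := by
      simp only [RatedMarket.profit, RatedMarket.payoff, hA, expectedPrice_mixingMarket]
      rfl
    linarith

theorem revealsOrPools_mixingMarket {T : Set ℝ} (hx : ∀ θ ∈ T, (g (q θ) : ℝ) ∈ uIcc (q θ : ℝ) x) :
    (mixingMarket hg hq x).RevealsOrPools T (revealProb g x) x := by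
  refine ⟨fun z => ((0 : ℕ), z), ((1 : ℕ), x), measurableEmbedding_prodMk_left (0 : ℕ),
    measurableSet_singleton (α := ℕ × ℝ≥0) _, ?_, rfl, fun θ hθ => ⟨rfl, if_pos (hx θ hθ)⟩⟩
  rintro ⟨z, hz⟩
  simpa using congrArg Prod.fst hz

end mixingMarket

end

theorem Market.measure_Ioo_pos (M : Market) {a b : ℝ} (ha : M.lo ≤ a) (hab : a < b)
    (hb : b ≤ M.hi) : 0 < M.F (Ioo a b) := by
  have hmem : (a + b) / 2 ∈ M.F.support := by
    rw [M.support_eq]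
    constructor <;> linarith
  exact Measure.mem_support_iff_forall _ |>.1 hmem _ (Ioo_mem_nhds (by linarith) (by linarith))

theorem Market.ae_Ico (M : Market) (c : ℝ) :
    ∀ᵐ θ ∂(M.F.restrict (Icc c M.hi)), θ ∈ Ico c M.hi := by
  have hne : ∀ᵐ θ ∂M.F, θ ≠ M.hi := by simp [ae_iff]
  filter_upwards [ae_restrict_mem measurableSet_Icc, ae_restrict_of_ae hne] with θ hθ hθ'
  exact ⟨hθ.1, lt_of_le_of_ne hθ.2 hθ'⟩

/-- Ordered functions with the same mean agree somewhere in every interval of types. -/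
theorem Market.exists_eq_of_integral_eq (M : Market) {c : ℝ} (hc : M.lo ≤ c) {f g : ℝ → ℝ}
    (hf : IntegrableOn f (Icc c M.hi) M.F) (hg : IntegrableOn g (Icc c M.hi) M.F)
    (hle : ∀ θ ∈ Ico c M.hi, f θ ≤ g θ)
    (heq : ∫ θ in Icc c M.hi, f θ ∂M.F = ∫ θ in Icc c M.hi, g θ ∂M.F) {a b : ℝ} (ha : c ≤ a)
    (hab : a < b) (hb : b ≤ M.hi) : ∃ θ ∈ Ioo a b, f θ = g θ := by
  by_contra! hne
  have h1 : ∫ θ in Icc c M.hi, (g θ - f θ) ∂M.F = 0 := by rw [integral_sub hg hf, heq, sub_self]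
  rw [integral_eq_zero_iff_of_nonneg_ae (f := fun θ => g θ - f θ) _ (hg.sub hf)] at h1
  · have h2 : M.F.restrict (Icc c M.hi) (Ioo a b) = 0 := by
      refine measure_mono_null (fun θ hθ => ?_) (ae_iff.1 h1)
      exact sub_ne_zero.2 (hne θ hθ).symm
    rw [Measure.restrict_apply measurableSet_Ioo, inter_eq_left.2] at h2
    · exact (M.measure_Ioo_pos (hc.trans ha) hab hb).ne' h2
    · exact fun θ hθ => ⟨ha.trans hθ.1.le, hθ.2.le.trans hb⟩
  · filter_upwards [M.ae_Ico c] with θ hθ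
    exact sub_nonneg.2 (hle θ hθ)

/-- If signaled quality `s` rises at most as fast as quality `q` and equals it on average, then it
lies between `q` and some generic quality `x`. -/
theorem Market.exists_generic_quality (M : Market) {c : ℝ} (hc : c ∈ Ico M.lo M.hi) {q s : ℝ → ℝ}
    (hq : MonotoneOn q (Icc c M.hi)) (hs : MonotoneOn s (Icc c M.hi))
    (hs0 : ∀ θ ∈ Icc c M.hi, 0 ≤ s θ) (hsq : AntitoneOn (fun θ => s θ - q θ) (Ico c M.hi))
    (heq : ∫ θ in Icc c M.hi, s θ ∂M.F = ∫ θ in Icc c M.hi, q θ ∂M.F) :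
    ∃ x : ℝ≥0, (∀ θ ∈ Ico c M.hi, s θ ∈ uIcc (q θ) x) ∧
      ((∀ θ ∈ Ico c M.hi, ∀ θ' ∈ Ico c M.hi, q θ < q θ' → s θ' - q θ' < s θ - q θ) →
        ∀ θ ∈ Ico c M.hi, s θ = q θ → q θ = x) := by
  have hsub : Ico c M.hi ⊆ Icc c M.hi := Ico_subset_Icc_self
  have hsi := hs.integrableOn_isCompact (μ := M.F) isCompact_Icc
  have hqi := hq.integrableOn_isCompact (μ := M.F) isCompact_Icc
  have hcc : c ∈ Ico c M.hi := ⟨le_rfl, hc.2⟩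
  by_cases hU : ∃ θ₀ ∈ Ico c M.hi, s θ₀ < q θ₀
  · obtain ⟨θ₀, hθ₀, hlt₀⟩ := hU
    have hcL : q c ≤ s c := by
      by_contra! hlt
      have hall : ∀ θ ∈ Ico c M.hi, s θ < q θ := fun θ hθ => by
        have := hsq hcc hθ hθ.1
        simp only at this
        linarith
      obtain ⟨θ, hθ, he⟩ := M.exists_eq_of_integral_eq hc.1 hsi hqi (fun θ hθ => (hall θ hθ).le) heq
        le_rfl hc.2 le_rfl
      exact (hall θ ⟨hθ.1.le, hθ.2⟩).ne he
    set L : Set ℝ := {θ | θ ∈ Ico c M.hi ∧ q θ ≤ s θ} with hL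
    have hbelow : ∀ θ ∈ L, ∀ θ' ∈ Ico c M.hi, s θ' < q θ' → s θ ≤ s θ' := by
      intro θ hθ θ' hθ' hlt
      rcases le_total θ θ' with h | h
      · exact hs (hsub hθ.1) (hsub hθ') h
      · have h1 := hsq hθ' hθ.1 h
        have h2 := hθ.2
        simp only at h1
        linarith
    have hne : (s '' L).Nonempty := ⟨_, c, ⟨hcc, hcL⟩, rfl⟩
    have hbdd : BddAbove (s '' L) := ⟨s θ₀, by
      rintro _ ⟨θ, hθ, rfl⟩
      exact hbelow θ hθ θ₀ hθ₀ hlt₀⟩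
    have hx0 : 0 ≤ sSup (s '' L) :=
      (hs0 c (hsub hcc)).trans (le_csSup hbdd ⟨c, ⟨hcc, hcL⟩, rfl⟩)
    refine ⟨(sSup (s '' L)).toNNReal, fun θ hθ => ?_, fun hstrict θ hθ he => ?_⟩
    · rw [Real.coe_toNNReal _ hx0]
      rcases le_or_gt (q θ) (s θ) with h | h
      · exact Icc_subset_uIcc ⟨h, le_csSup hbdd ⟨θ, ⟨hθ, h⟩, rfl⟩⟩
      · refine Icc_subset_uIcc' ⟨csSup_le hne ?_, h.le⟩
        rintro _ ⟨θ', hθ', rfl⟩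
        exact hbelow θ' hθ' θ hθ h
    · rw [Real.coe_toNNReal _ hx0]
      refine le_antisymm (he ▸ le_csSup hbdd ⟨θ, ⟨hθ, he.ge⟩, rfl⟩) (csSup_le hne ?_)
      rintro _ ⟨θ', ⟨hθ', hle'⟩, rfl⟩
      by_contra! hlt
      have hlt' : θ < θ' := by
        by_contra! h
        have := hs (hsub hθ') (hsub hθ) h
        linarith
      have h1 := hsq hθ hθ' hlt'.le
      simp only at h1
      have h2 := hstrict θ hθ θ' hθ' (by linarith)
      linarith
  · push Not at hU
    have heq' : ∀ θ ∈ Ioo c M.hi, s θ = q θ := by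
      intro θ hθ
      refine le_antisymm ?_ (hU θ ⟨hθ.1.le, hθ.2⟩)
      obtain ⟨θ', hθ', he⟩ := M.exists_eq_of_integral_eq hc.1 hqi hsi hU heq.symm le_rfl hθ.1
        hθ.2.le
      have := hsq ⟨hθ'.1.le, hθ'.2.trans hθ.2⟩ ⟨hθ.1.le, hθ.2⟩ hθ'.2.le
      simp only at this
      linarith
    obtain ⟨m, hm⟩ := exists_between hc.2
    have hm' : m ∈ Ico c M.hi := ⟨hm.1.le, hm.2⟩
    refine ⟨(s m).toNNReal, fun θ hθ => ?_, fun hstrict θ hθ he => ?_⟩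
    · rw [Real.coe_toNNReal _ (hs0 m (hsub hm'))]
      rcases hθ.1.eq_or_lt with rfl | h
      · exact Icc_subset_uIcc ⟨hU _ hθ, hs (hsub hθ) (hsub hm') hm.1.le⟩
      · rw [heq' θ ⟨h, hθ.2⟩]
        exact left_mem_uIcc
    · rw [Real.coe_toNNReal _ (hs0 m (hsub hm'))]
      have hem := heq' m hm
      rcases lt_trichotomy (q θ) (q m) with h | h | h
      · have := hstrict θ hθ m hm' h
        linarith
      · linarith
      · have := hstrict m hm' θ hθ h
        linarith

/-- A mechanism in which marginal costs do not exceed `1` and signaled quality equals quality on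
average is implemented by a mixing rating. -/
theorem Market.IsContract.exists_isEquilibrium {M : Market} {c : ℝ} {q P : ℝ → ℝ}
    (h : M.IsContract c q P) (hc : c ∈ Ico M.lo M.hi) (hP : 0 ≤ P c)
    (hle : ∀ t ∈ Ico c M.hi, costQ M.cost (q t) t ≤ 1)
    (heq : ∫ θ in Icc c M.hi, (P θ + M.cost (q θ) θ) ∂M.F = ∫ θ in Icc c M.hi, q θ ∂M.F) :
    ∃ A : RatedMarket, IsEquilibrium M c A ∧ A.profit M c = P c := by
  have hcI : c ∈ Icc M.lo M.hi := ⟨hc.1, hc.2.le⟩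
  have hcc : c ∈ Icc c M.hi := ⟨le_rfl, hc.2.le⟩
  have hL : ∀ t ∈ Icc c M.hi, t ∈ Icc M.lo M.hi := fun t ht => ⟨hc.1.trans ht.1, ht.2⟩
  have hP' : ∀ t ∈ Icc c M.hi, 0 ≤ P t := fun t ht => hP.trans (h.monotone_profit hc.1 hcc ht ht.1)
  have hs := h.monotone_signaled hc.1
  have hs0 : ∀ t ∈ Icc c M.hi, 0 ≤ P t + M.cost (q t) t := fun t ht =>
    add_nonneg (hP' t ht) (M.cost_nonneg (h.quality_nonneg t ht) (hL t ht))
  obtain ⟨x, hx, -⟩ := M.exists_generic_quality hc h.monotone_quality hs hs0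
    (h.antitone_signaled_sub hc.1 hle) heq
  have hne : Nonempty (Icc c M.hi) := ⟨⟨c, hcc⟩⟩
  let G : ℝ≥0 → ℝ := fun z => ⨅ t : Icc c M.hi, (P t + M.cost z t)
  have hterm : ∀ (z : ℝ≥0) (t : Icc c M.hi), 0 ≤ P t + M.cost z t := fun z t =>
    add_nonneg (hP' t t.2) (M.cost_nonneg z.2 (hL t t.2))
  have hbdd : ∀ z : ℝ≥0, BddBelow (range fun t : Icc c M.hi => P t + M.cost z t) := fun z =>
    ⟨0, by rintro _ ⟨t, rfl⟩; exact hterm z t⟩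
  have hG0 : ∀ z, 0 ≤ G z := fun z => le_ciInf (hterm z)
  have hGm : Monotone G := fun z z' hzz => ciInf_mono (hbdd z) fun t =>
    add_le_add_right (M.monotoneOn_cost (hL t t.2) z.2 z'.2 (NNReal.coe_le_coe.2 hzz)) _
  let g : ℝ≥0 → ℝ≥0 := fun z => (G z).toNNReal
  have hg : Measurable g := (hGm.measurable).real_toNNReal
  have hgG : ∀ z, (g z : ℝ) = G z := fun z => Real.coe_toNNReal _ (hG0 z)
  let Q : ℝ → ℝ≥0 := fun θ => (q (clamp c M.hi θ)).toNNReal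
  have hQ : Measurable Q := (h.monotone_quality.comp_clamp hcI.2).measurable.real_toNNReal
  have hQq : ∀ θ ∈ Icc c M.hi, (Q θ : ℝ) = q θ := fun θ hθ => by
    simp only [Q, clamp_of_mem hθ]
    exact Real.coe_toNNReal _ (h.quality_nonneg θ hθ)
  have hgQ : ∀ θ ∈ Icc c M.hi, (g (Q θ) : ℝ) = P θ + M.cost (q θ) θ := by
    intro θ hθ
    rw [hgG, ← hQq θ hθ]
    refine le_antisymm (ciInf_le (hbdd _) ⟨θ, hθ⟩) (le_ciInf fun t => ?_)
    rw [hQq θ hθ]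
    have := h.incentive θ hθ t t.2
    linarith
  have hic : ∀ θ ∈ Icc c M.hi, ∀ z : ℝ≥0, (g z : ℝ) - M.cost z θ ≤ g (Q θ) - M.cost (Q θ) θ := by
    intro θ hθ z
    rw [hgQ θ hθ, hQq θ hθ, hgG]
    have : G z ≤ P θ + M.cost z θ := ciInf_le (hbdd z) ⟨θ, hθ⟩
    linarith
  refine ⟨mixingMarket hg hQ x, isEquilibrium_mixingMarket hg hQ x hcI ?_ ?_ ?_ hic ?_, ?_⟩
  · exact (h.monotone_quality.integrableOn_isCompact isCompact_Icc).congr_fun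
      (fun θ hθ => (hQq θ hθ).symm) measurableSet_Icc
  · exact (hs.integrableOn_isCompact isCompact_Icc).congr_fun
      (fun θ hθ => (hgQ θ hθ).symm) measurableSet_Icc
  · rw [setIntegral_congr_fun measurableSet_Icc hgQ, setIntegral_congr_fun measurableSet_Icc hQq,
      heq]
  · intro θ hθ
    rw [hgQ θ (Ico_subset_Icc_self hθ), hQq θ (Ico_subset_Icc_self hθ)]
    exact hx θ hθ
  · have h1 : (mixingMarket hg hQ x).profit M c = g (Q c) - M.cost (Q c) c := by
      simp only [RatedMarket.profit, RatedMarket.payoff, expectedPrice_mixingMarket]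
      rfl
    rw [h1, hgQ c hcc, hQq c hcc]
    ring

theorem RatedMarket.profit_add_cost (A : RatedMarket) (M : Market) (θ : ℝ) :
    A.profit M θ + M.cost (A.quality θ) θ = A.signaled θ := by
  simp [RatedMarket.profit, RatedMarket.payoff, RatedMarket.signaled]

theorem RatedMarket.expectedPrice_nonneg (A : RatedMarket) (z : ℝ≥0) : 0 ≤ A.expectedPrice z :=
  integral_nonneg fun _ => NNReal.coe_nonneg _

theorem IsEquilibrium.incentive {M : Market} {c : ℝ} {A : RatedMarket} (h : IsEquilibrium M c A)
    {s t : ℝ} (ht : t ∈ Icc c M.hi) :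
    A.profit M s + M.cost (A.quality s) s - M.cost (A.quality s) t ≤ A.profit M t := by
  rw [A.profit_add_cost]
  exact h.optimal t ht (A.quality s)

theorem IsEquilibrium.isContract {M : Market} {c : ℝ} {A : RatedMarket} (h : IsEquilibrium M c A)
    (hmono : MonotoneOn A.quality (Icc c M.hi)) :
    M.IsContract c (fun θ => A.quality θ) (A.profit M) where
  quality_nonneg _ _ := NNReal.coe_nonneg _
  monotone_quality _ hs _ ht hst := NNReal.coe_le_coe.2 (hmono hs ht hst)
  incentive _ _ _ ht := h.incentive ht

theorem IsEquilibrium.monotoneOn_quality {M : Market} {c : ℝ} {A : RatedMarket}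
    (h : IsEquilibrium M c A) (hM : M.StrictlySubmodular) :
    MonotoneOn A.quality (Icc c M.hi) := by
  intro s hs t ht hst
  rcases hst.eq_or_lt with rfl | hst
  · rfl
  by_contra! hlt
  have hc := h.cutoff_mem.1
  have h1 := hM (A.quality t) (A.quality s) s t (NNReal.coe_nonneg _) (NNReal.coe_lt_coe.2 hlt)
    ⟨hc.trans hs.1, hs.2⟩ ⟨hc.trans ht.1, ht.2⟩ hst
  have h2 := h.incentive (s := s) ht
  have h3 := h.incentive (s := t) hs
  linarith

theorem IsParetoOptimal.profit_le {M : Market} {c : ℝ} {A A' : RatedMarket}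
    (h : IsParetoOptimal M c (Measure.dirac c) A) (h' : IsEquilibrium M c A') :
    A'.profit M c ≤ A.profit M c := by
  simpa using h.2 A' h'

theorem Market.measureReal_pos (M : Market) {c : ℝ} (hc : c ∈ Ico M.lo M.hi) :
    0 < M.F.real (Icc c M.hi) := by
  have := M.measure_Ioo_pos hc.1 hc.2 le_rfl
  exact ENNReal.toReal_pos (this.trans_le (measure_mono Ioo_subset_Icc_self)).ne'
    (measure_ne_top _ _)

/-- A mechanism with marginal costs at most `1` and the profit of the lowest type in an optimal
equilibrium cannot generate a surplus. -/
theorem IsParetoOptimal.integral_quality_le {M : Market} {c : ℝ} {A : RatedMarket}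
    (h : IsParetoOptimal M c (Measure.dirac c) A) (hc : c ∈ Ico M.lo M.hi) {q P : ℝ → ℝ}
    (h' : M.IsContract c q P) (hP : P c = A.profit M c)
    (hle : ∀ t ∈ Ico c M.hi, costQ M.cost (q t) t ≤ 1) :
    ∫ θ in Icc c M.hi, q θ ∂M.F ≤ ∫ θ in Icc c M.hi, (P θ + M.cost (q θ) θ) ∂M.F := by
  by_contra! hlt
  have hm := M.measureReal_pos hc
  set K := (∫ θ in Icc c M.hi, q θ ∂M.F - ∫ θ in Icc c M.hi, (P θ + M.cost (q θ) θ) ∂M.F) /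
    M.F.real (Icc c M.hi) with hK
  have hK0 : 0 < K := div_pos (sub_pos.2 hlt) hm
  have hs := (h'.monotone_signaled hc.1).integrableOn_isCompact (μ := M.F) isCompact_Icc
  have h'' : M.IsContract c q (fun t => P t + K) :=
    ⟨h'.quality_nonneg, h'.monotone_quality, fun s hs t ht => by
      have := h'.incentive s hs t ht
      linarith⟩
  have hcc : c ∈ Icc c M.hi := ⟨le_rfl, hc.2.le⟩
  have h0 := h.1.participate c hcc
  obtain ⟨A', hA', hA'P⟩ := h''.exists_isEquilibrium hc (by linarith) hle (by
    have : ∀ θ, P θ + K + M.cost (q θ) θ = (P θ + M.cost (q θ) θ) + K := fun θ => by ring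
    simp only [this]
    rw [integral_add hs (integrable_const _), integral_const, measureReal_restrict_apply_univ,
      smul_eq_mul, hK]
    field_simp
    ring)
  have := h.profit_le hA'
  linarith

/-- Under an optimal rating the marginal costs of the producing types do not exceed `1`. -/
theorem IsParetoOptimal.costQ_quality_le_one {M : Market} {c : ℝ} {A : RatedMarket}
    (h : IsParetoOptimal M c (Measure.dirac c) A)
    (hc : c ∈ Ico M.lo M.hi) (hmono : MonotoneOn A.quality (Icc c M.hi)) :
    ∀ t ∈ Ico c M.hi, costQ M.cost (A.quality t) t ≤ 1 := by
  have hA := h.1.isContract hmono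
  have hcc : c ∈ Icc c M.hi := ⟨le_rfl, hc.2.le⟩
  have hL : ∀ t ∈ Icc c M.hi, t ∈ Icc M.lo M.hi := fun t ht => ⟨hc.1.trans ht.1, ht.2⟩
  let Z : ℝ → Set ℝ := fun t => {z | z ∈ Icc 0 (A.quality t : ℝ) ∧ costQ M.cost z t ≤ 1}
  let q : ℝ → ℝ := fun t => sSup (Z t)
  have hbdd : ∀ t, BddAbove (Z t) := fun t => ⟨A.quality t, fun z hz => hz.1.2⟩
  have hqZ : ∀ t ∈ Icc c M.hi, q t ∈ Z t := by
    intro t ht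
    have hcont : ContinuousOn (fun z => costQ M.cost z t) (Icc 0 (A.quality t : ℝ)) :=
      M.contDiffOn_costQ.continuousOn.comp (f := fun z => (z, t)) (by fun_prop)
        (fun z hz => ⟨hz.1, hL t ht⟩)
    have hclosed : IsClosed (Z t) := hcont.preimage_isClosed_of_isClosed isClosed_Icc isClosed_Iic
    refine hclosed.csSup_mem ⟨0, ⟨le_rfl, NNReal.coe_nonneg _⟩, ?_⟩ (hbdd t)
    rw [M.costQ_zero t (hL t ht)]
    exact zero_le_one
  have hq0 : ∀ t ∈ Icc c M.hi, 0 ≤ q t := fun t ht => (hqZ t ht).1.1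
  have hqm : MonotoneOn q (Icc c M.hi) := by
    intro s hs t ht hst
    refine le_csSup (hbdd t) ⟨⟨hq0 s hs, (hqZ s hs).1.2.trans
      (hA.monotone_quality hs ht hst)⟩, ?_⟩
    exact (M.antitoneOn_costQ (hq0 s hs) (hL s hs) (hL t ht) hst).trans (hqZ s hs).2
  obtain ⟨P, hP, hPc⟩ := M.exists_isContract (hL c hcc) hq0 hqm (A.profit M c)
  have hPle : ∀ t ∈ Icc c M.hi, P t ≤ A.profit M t := by
    intro t ht
    have := hA.antitone_profit_sub hP hc.1 (fun t ht => (hqZ t ht).1.2) hcc ht ht.1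
    simp only at this
    linarith
  have hsurplus : ∀ t ∈ Icc c M.hi, q t < A.quality t →
      A.quality t - q t < M.cost (A.quality t) t - M.cost (q t) t := by
    intro t ht hlt
    obtain ⟨x, hx, he⟩ := M.exists_costQ_eq_slope (hq0 t ht) hlt (hL t ht)
    have hx1 : 1 < costQ M.cost x t := by
      by_contra! hx1
      exact hx.1.not_ge (le_csSup (hbdd t) ⟨⟨(hq0 t ht).trans hx.1.le, hx.2.le⟩, hx1⟩)
    rw [he]
    nlinarith
  have hsurplus' : ∀ t ∈ Icc c M.hi,
      A.quality t - q t ≤ M.cost (A.quality t) t - M.cost (q t) t := by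
    intro t ht
    rcases (hqZ t ht).1.2.eq_or_lt with he | hlt
    · rw [he, sub_self, sub_self]
    · exact (hsurplus t ht hlt).le
  have hq := hqm.integrableOn_isCompact (μ := M.F) isCompact_Icc
  have hs := (hP.monotone_signaled hc.1).integrableOn_isCompact (μ := M.F) isCompact_Icc
  obtain ⟨hsA, hsq⟩ := h.1.integral_signaled
  have hsub : Ico c M.hi ⊆ Icc c M.hi := Ico_subset_Icc_self
  have hle : ∀ t ∈ Ico c M.hi,
      A.quality t - A.signaled t ≤ q t - (P t + M.cost (q t) t) := by
    intro t ht
    have h1 := hsurplus' t (hsub ht)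
    have h2 := hPle t (hsub ht)
    have h3 := A.profit_add_cost M t
    linarith
  have hint : ∫ θ in Icc c M.hi, (A.quality θ - A.signaled θ) ∂M.F =
      ∫ θ in Icc c M.hi, (q θ - (P θ + M.cost (q θ) θ)) ∂M.F := by
    refine le_antisymm ?_ ?_
    · refine integral_mono_ae (h.1.integrable_quality.sub hsA) (hq.sub hs) ?_
      filter_upwards [M.ae_Ico c] with t ht using hle t ht
    · have := h.integral_quality_le hc hP hPc (fun t ht => (hqZ t (hsub ht)).2)
      rw [integral_sub h.1.integrable_quality hsA, integral_sub hq hs]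
      linarith
  intro t ht
  refine le_of_forall_pos_le_add fun ε hε => ?_
  obtain ⟨δ, hδ, hd⟩ := M.exists_costQ_sub_le (A.quality t) hε
  obtain ⟨u, hu, he⟩ := M.exists_eq_of_integral_eq hc.1 (h.1.integrable_quality.sub hsA)
    (hq.sub hs) hle hint ht.1 (lt_min (lt_add_of_pos_right t hδ) ht.2) (min_le_right (t + δ) M.hi)
  have hu1 : u < t + δ := hu.2.trans_le (min_le_left _ _)
  have hu' : u ∈ Icc c M.hi := ⟨ht.1.trans hu.1.le, hu.2.le.trans (min_le_right _ _)⟩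
  have hqu : q u = A.quality u := by
    refine (hqZ u hu').1.2.antisymm ?_
    by_contra! hlt
    have h1 := hsurplus u hu' hlt
    have h2 := hPle u hu'
    have h3 := A.profit_add_cost M u
    simp only [Pi.sub_apply] at he
    linarith
  have h1 := (hqZ u hu').2
  rw [hqu] at h1
  have h2 := M.monotoneOn_costQ (hL u hu') (NNReal.coe_nonneg _) (NNReal.coe_nonneg _)
    (hA.monotone_quality (hsub ht) hu' hu.1.le)
  have h3 := hd _ ⟨NNReal.coe_nonneg _, le_rfl⟩ t (hL t (hsub ht)) u (hL u hu')
    (by rw [abs_of_pos (sub_pos.2 hu.1)]; linarith)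
  simp only at h2
  linarith

theorem Market.exists_measureReal_Ioc_lt (M : Market) {a b ε : ℝ} (hab : a < b) (hε : 0 < ε) :
    ∃ t ∈ Ioc a b, M.F.real (Ioc a t) < ε := by
  have h1 : Filter.Tendsto (cdf M.F) (nhdsWithin a (Ioi a)) (nhds (cdf M.F a)) :=
    ((cdf M.F).right_continuous a).mono_left (nhdsWithin_mono a Ioi_subset_Ici_self)
  have h2 := h1.eventually_lt_const (lt_add_of_pos_right (cdf M.F a) hε)
  obtain ⟨t, ht, htab⟩ := (h2.and (Ioc_mem_nhdsGT hab)).exists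
  refine ⟨t, htab, ?_⟩
  rw [← Iic_sdiff_Iic, measureReal_sdiff (Iic_subset_Iic.2 htab.1.le) measurableSet_Iic,
    ← cdf_eq_real, ← cdf_eq_real]
  linarith

/-- If signaled quality rose as fast as quality between two types, it would pay to pool the types
between them at the lower quality. -/
theorem IsParetoOptimal.signaled_sub_lt {M : Market} {c : ℝ} {A : RatedMarket}
    (h : IsParetoOptimal M c (Measure.dirac c) A) (hc : c ∈ Ico M.lo M.hi)
    (hM : M.StrictlySubmodular) :
    ∀ θ ∈ Ico c M.hi, ∀ θ' ∈ Ico c M.hi, (A.quality θ : ℝ) < A.quality θ' →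
      A.signaled θ' - A.quality θ' < A.signaled θ - A.quality θ := by
  have hmono := h.1.monotoneOn_quality hM
  have hA := h.1.isContract hmono
  have hslope := h.costQ_quality_le_one hc hmono
  have hsub : Ico c M.hi ⊆ Icc c M.hi := Ico_subset_Icc_self
  have hcc : c ∈ Icc c M.hi := ⟨le_rfl, hc.2.le⟩
  have hhi : M.hi ∈ Icc c M.hi := ⟨hc.2.le, le_rfl⟩
  have hL : ∀ t ∈ Icc c M.hi, t ∈ Icc M.lo M.hi := fun t ht => ⟨hc.1.trans ht.1, ht.2⟩
  have hanti : AntitoneOn (fun t => A.signaled t - A.quality t) (Ico c M.hi) := by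
    simpa only [A.profit_add_cost] using hA.antitone_signaled_sub hc.1 hslope
  intro a ha b hb hqab
  by_contra! hle
  have hab : a < b := by
    by_contra! hba
    exact (hA.monotone_quality (hsub hb) (hsub ha) hba).not_gt hqab
  have heq : A.signaled b - A.quality b = A.signaled a - A.quality a :=
    (hanti ha hb hab.le).antisymm hle
  have hqa := (A.quality a).coe_nonneg
  have hqb := (A.quality b).coe_nonneg
  have hsa := A.profit_add_cost M a
  have hsb := A.profit_add_cost M b
  set qa : ℝ := (A.quality a : ℝ)
  set qb : ℝ := (A.quality b : ℝ)
  let r : ℝ → ℝ := fun t => (qb - qa) - (M.cost qb t - M.cost qa t)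
  have hrmono : MonotoneOn r (Icc M.lo M.hi) := fun s hs t ht hst => by
    have := M.submodular hqa hqab.le hs ht hst
    simp only [r]
    linarith
  have hrb : 0 ≤ r b := by
    have := hA.incentive a (hsub ha) b (hsub hb)
    simp only [r]
    linarith
  have hrpos : ∀ t ∈ Icc c M.hi, b < t → 0 < r t := fun t ht hbt => by
    have := hM qa qb b t hqa hqab (hL b (hsub hb)) (hL t ht) hbt
    simp only [r] at hrb ⊢
    linarith
  set N : ℝ := (A.quality M.hi - qb) / (qb - qa) with hN
  have hqhi : qb ≤ A.quality M.hi := hA.monotone_quality (hsub hb) hhi hb.2.le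
  have hN0 : 0 ≤ N := div_nonneg (sub_nonneg.2 hqhi) (sub_nonneg.2 hqab.le)
  set m := (b + M.hi) / 2 with hm
  have hbm : b < m := by have := hb.2; simp only [hm]; linarith
  have hmhi : m < M.hi := by have := hb.2; simp only [hm]; linarith
  have hcm : c ≤ m := hb.1.trans hbm.le
  have hFm := M.measureReal_pos (c := m) ⟨hc.1.trans hcm, hmhi⟩
  obtain ⟨d, hd, hFd⟩ := M.exists_measureReal_Ioc_lt hbm (ε := M.F.real (Icc m M.hi) / (N + 1))
    (by positivity)
  have hFd' : N * M.F.real (Ioc b d) < M.F.real (Icc m M.hi) := by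
    rw [lt_div_iff₀ (by positivity)] at hFd
    nlinarith [measureReal_nonneg (μ := M.F) (s := Ioc b d)]
  have hdI : d ∈ Icc c M.hi := ⟨hb.1.trans hd.1.le, hd.2.trans hmhi.le⟩
  have hrd := hrpos d hdI hd.1
  classical
  let q : ℝ → ℝ := fun t => if t ∈ Ico a d then qa else A.quality t
  have hq_in : ∀ t ∈ Ico a d, q t = qa := fun t ht => if_pos ht
  have hq_out : ∀ t, t ∉ Ico a d → q t = A.quality t := fun t ht => if_neg ht
  have hq0 : ∀ t ∈ Icc c M.hi, 0 ≤ q t := fun t _ => by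
    simp only [q]
    split_ifs
    exacts [hqa, NNReal.coe_nonneg _]
  have hqle : ∀ t ∈ Icc c M.hi, q t ≤ A.quality t := fun t ht => by
    by_cases htI : t ∈ Ico a d
    · rw [hq_in t htI]
      exact hA.monotone_quality (hsub ha) ht htI.1
    · rw [hq_out t htI]
  have hqm : MonotoneOn q (Icc c M.hi) := by
    intro s hs t ht hst
    by_cases htI : t ∈ Ico a d
    · by_cases hsI : s ∈ Ico a d
      · rw [hq_in s hsI, hq_in t htI]
      · have hsa' : s ≤ a := by
          by_contra! hlt
          exact hsI ⟨hlt.le, hst.trans_lt htI.2⟩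
        rw [hq_out s hsI, hq_in t htI]
        exact hA.monotone_quality hs (hsub ha) hsa'
    · rw [hq_out t htI]
      exact (hqle s hs).trans (hA.monotone_quality hs ht hst)
  obtain ⟨P, hP, hPc⟩ := M.exists_isContract (hL c hcc) hq0 hqm (A.profit M c)
  have hD := hA.antitone_profit_sub hP hc.1 hqle
  have hPle : ∀ t ∈ Icc c M.hi, P t ≤ A.profit M t := by
    intro t ht
    have := hD hcc ht ht.1
    simp only at this
    linarith
  have hPmid : ∀ t ∈ Ico a d, P t ≤ A.signaled a - M.cost qa t := by
    intro t ht
    have ht' : t ∈ Icc c M.hi := ⟨ha.1.trans ht.1, ht.2.le.trans hdI.2⟩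
    have h1 := hP.incentive t ht' a (hsub ha)
    rw [hq_in t ht] at h1
    have h2 := hPle a (hsub ha)
    linarith
  have hPhigh : ∀ t ∈ Icc d M.hi, P t - A.profit M t ≤ -r d := by
    intro t ht
    have ht' : t ∈ Icc c M.hi := ⟨hdI.1.trans ht.1, ht.2⟩
    have hrcont : ContinuousOn r (Icc M.lo M.hi) := continuousOn_const.sub
      ((M.continuousOn_cost_snd hqb).sub (M.continuousOn_cost_snd hqa))
    have hsubI : Ioo b d ⊆ Icc M.lo M.hi := fun u hu =>
      hL u ⟨hb.1.trans hu.1.le, hu.2.le.trans hdI.2⟩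
    have htend := ((hrcont d (hL d hdI)).mono hsubI).neg.tendsto
    have := right_nhdsWithin_Ioo_neBot hd.1
    refine ge_of_tendsto htend ?_
    filter_upwards [self_mem_nhdsWithin] with u hu
    have hu' : u ∈ Icc c M.hi := ⟨hb.1.trans hu.1.le, hu.2.le.trans hdI.2⟩
    have h1 := hD hu' ht' (hu.2.le.trans ht.1)
    have h2 := hPmid u ⟨hab.le.trans hu.1.le, hu.2⟩
    have h3 := hA.incentive b (hsub hb) u hu'
    simp only [r, Pi.neg_apply] at h1 ⊢
    linarith
  let φ : ℝ → ℝ := fun t =>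
    (Icc m M.hi).indicator (fun _ => r d) t - (Ioc b d).indicator (fun _ => N * r d) t
  have hφ : ∀ t ∈ Ico c M.hi,
      (A.quality t - A.signaled t) + φ t ≤ q t - (P t + M.cost (q t) t) := by
    intro t ht
    have ht' := hsub ht
    have hst := A.profit_add_cost M t
    have hNr : 0 ≤ N * r d := mul_nonneg hN0 hrd.le
    rcases lt_or_ge t d with htd | hdt
    · have h1 : (Icc m M.hi).indicator (fun _ => r d) t = 0 :=
        indicator_of_notMem (fun hmt => (htd.trans_le hd.2).not_ge hmt.1) _
      rcases lt_or_ge t a with hta | hat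
      · have h2 : (Ioc b d).indicator (fun _ => N * r d) t = 0 :=
          indicator_of_notMem (fun hbt => (hta.trans hab).not_gt hbt.1) _
        rw [hq_out t (fun hI => hta.not_ge hI.1)]
        have h3 := hPle t ht'
        simp only [φ, h1, h2]
        linarith
      · have h3 := hPmid t ⟨hat, htd⟩
        rw [hq_in t ⟨hat, htd⟩]
        rcases le_or_gt t b with htb | hbt
        · have h2 : (Ioc b d).indicator (fun _ => N * r d) t = 0 :=
            indicator_of_notMem (fun hbt => htb.not_gt hbt.1) _
          have h4 := hanti ht hb htb
          simp only [φ, h1, h2] at h4 ⊢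
          linarith
        · have h2 : (Ioc b d).indicator (fun _ => N * r d) t = N * r d :=
            indicator_of_mem (s := Ioc b d) ⟨hbt, htd.le⟩ _
          have h4 := hA.incentive b (hsub hb) t ht'
          have hqbt : qb ≤ A.quality t := hA.monotone_quality (hsub hb) ht' hbt.le
          have hqt : (A.quality t : ℝ) ≤ A.quality M.hi := hA.monotone_quality ht' hhi ht.2.le
          have h5 := M.le_cost_sub hqb hqbt (hL t ht')
          have h6 := M.cost_sub_le hqa hqab.le (hL t ht')
          have h7 : r t ≤ r d := hrmono (hL t ht') (hL d hdI) htd.le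
          set k := costQ M.cost qb t with hk
          have h8 : (qb - qa) * (1 - k) ≤ r d := by
            simp only [r] at h7 ⊢
            linarith
          have h9 : 1 - k ≤ r d / (qb - qa) := by
            rw [le_div_iff₀ (sub_pos.2 hqab)]
            linarith
          have h10 : (A.quality t - qb) * (1 - k) ≤ N * r d := by
            calc (A.quality t - qb) * (1 - k) ≤ (A.quality t - qb) * (r d / (qb - qa)) :=
                  mul_le_mul_of_nonneg_left h9 (sub_nonneg.2 hqbt)
              _ ≤ (A.quality M.hi - qb) * (r d / (qb - qa)) :=
                  mul_le_mul_of_nonneg_right (by linarith)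
                    (div_nonneg hrd.le (sub_nonneg.2 hqab.le))
              _ = N * r d := by rw [hN]; ring
          simp only [φ, h1, h2]
          linarith
    · have h1 : (Icc m M.hi).indicator (fun _ => r d) t ≤ r d :=
        indicator_le' (fun _ _ => le_rfl) (fun _ _ => hrd.le) t
      have h2 : 0 ≤ (Ioc b d).indicator (fun _ => N * r d) t :=
        indicator_nonneg (fun _ _ => hNr) t
      have h3 := hPhigh t ⟨hdt, ht.2.le⟩
      rw [hq_out t (fun hI => hdt.not_gt hI.2)]
      simp only [φ]
      linarith
  have hIoc : Ioc b d ⊆ Icc c M.hi := fun t ht => ⟨hb.1.trans ht.1.le, ht.2.trans hdI.2⟩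
  obtain ⟨hsA, hsq⟩ := h.1.integral_signaled
  have hq := hqm.integrableOn_isCompact (μ := M.F) isCompact_Icc
  have hs := (hP.monotone_signaled hc.1).integrableOn_isCompact (μ := M.F) isCompact_Icc
  have hφ1 : IntegrableOn ((Icc m M.hi).indicator fun _ => r d) (Icc c M.hi) M.F :=
    (integrable_const _).indicator measurableSet_Icc
  have hφ2 : IntegrableOn ((Ioc b d).indicator fun _ => N * r d) (Icc c M.hi) M.F :=
    (integrable_const _).indicator measurableSet_Ioc
  have h1 : ∫ t in Icc c M.hi, ((A.quality t - A.signaled t) + φ t) ∂M.F ≤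
      ∫ t in Icc c M.hi, (q t - (P t + M.cost (q t) t)) ∂M.F := by
    refine integral_mono_ae ((h.1.integrable_quality.sub hsA).add (hφ1.sub hφ2)) (hq.sub hs) ?_
    filter_upwards [M.ae_Ico c] with t ht using hφ t ht
  have h2 : ∫ t in Icc c M.hi, φ t ∂M.F =
      (M.F.real (Icc m M.hi) - N * M.F.real (Ioc b d)) * r d := by
    simp only [φ]
    rw [integral_sub hφ1 hφ2, integral_indicator measurableSet_Icc,
      integral_indicator measurableSet_Ioc, Measure.restrict_restrict measurableSet_Icc,
      Measure.restrict_restrict measurableSet_Ioc, inter_eq_left.2 (Icc_subset_Icc_left hcm),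
      inter_eq_left.2 hIoc]
    simp only [integral_const, measureReal_restrict_apply_univ, smul_eq_mul]
    ring
  have hφi : IntegrableOn φ (Icc c M.hi) M.F := hφ1.sub hφ2
  have hAi : IntegrableOn (fun t => A.quality t - A.signaled t) (Icc c M.hi) M.F :=
    h.1.integrable_quality.sub hsA
  rw [integral_add hAi hφi,
    integral_sub h.1.integrable_quality hsA, hsq, integral_sub hq hs, h2] at h1
  have h3 := h.integral_quality_le hc hP hPc fun t ht =>
    (M.monotoneOn_costQ (hL t (hsub ht)) (hq0 t (hsub ht)) (NNReal.coe_nonneg _)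
      (hqle t (hsub ht))).trans (hslope t ht)
  have h4 := mul_pos (sub_pos.2 hFd') hrd
  linarith

/-- Every equilibrium is an entry equilibrium for the fee that extracts the profit of the lowest
producing type. -/
theorem IsEquilibrium.isEntryEquilibrium {M : Market} {c : ℝ} {A : RatedMarket}
    (h : IsEquilibrium M c A) : IsEntryEquilibrium M (A.profit M c) c A := by
  have hc := h.cutoff_mem
  have hcc : c ∈ Icc c M.hi := ⟨le_rfl, hc.2⟩
  refine ⟨h.participate c hcc, h, fun θ hθ => ?_, fun θ hθ z => ?_⟩
  · have h1 := h.incentive (s := c) hθ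
    have h2 := M.antitoneOn_cost (A.quality c).2 hc ⟨hc.1.trans hθ.1, hθ.2⟩ hθ.1
    simp only [NNReal.val_eq_coe] at h2
    linarith
  · have h1 := h.optimal c hcc z
    have h2 := M.antitoneOn_cost z.2 ⟨hθ.1, hθ.2.le.trans hc.2⟩ hc hθ.2.le
    simp only [RatedMarket.payoff, NNReal.val_eq_coe] at h1 h2 ⊢
    linarith

theorem IsEntryEquilibrium.fee_le {M : Market} {e c : ℝ} {A : RatedMarket}
    (h : IsEntryEquilibrium M e c A) : e ≤ A.profit M c :=
  h.enter c ⟨le_rfl, h.equilibrium.cutoff_mem.2⟩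

theorem Market.cdf_lt_one (M : Market) {c : ℝ} (hc : c ∈ Ico M.lo M.hi) : cdf M.F c < 1 := by
  have h1 := M.measure_Ioo_pos hc.1 hc.2 le_rfl
  have h2 : 0 < M.F.real (Ioi c) := ENNReal.toReal_pos
    (h1.trans_le (measure_mono Ioo_subset_Ioi_self)).ne' (measure_ne_top _ _)
  have h3 := probReal_compl_eq_one_sub (μ := M.F) (measurableSet_Iic (a := c))
  rw [compl_Iic, ← cdf_eq_real] at h3
  linarith

theorem Market.cdf_hi (M : Market) : cdf M.F M.hi = 1 := by
  have h1 : ∀ᵐ θ ∂M.F, θ ∈ Iic M.hi := by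
    have h := Measure.support_mem_ae (μ := M.F)
    rw [M.support_eq] at h
    filter_upwards [h] with θ hθ using hθ.2
  have h2 : M.F (Iic M.hi) = 1 := (prob_compl_eq_zero_iff measurableSet_Iic).1 (ae_iff.1 h1)
  rw [cdf_eq_real, measureReal_def, h2, ENNReal.toReal_one]

theorem isRevenueMaximizingAt_iff (M : Market) {c : ℝ} (hc : c ∈ Ico M.lo M.hi) (e : ℝ)
    (A : RatedMarket) : IsRevenueMaximizingAt M c e A ↔
      e = A.profit M c ∧ IsParetoOptimal M c (Measure.dirac c) A := by
  have hpos : 0 < 1 - cdf M.F c := sub_pos.2 (M.cdf_lt_one hc)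
  constructor
  · rintro ⟨h, hmax⟩
    have hle : ∀ A', IsEquilibrium M c A' → A'.profit M c ≤ e := fun A' hA' =>
      le_of_mul_le_mul_right (hmax _ A' hA'.isEntryEquilibrium) hpos
    have he := h.fee_le.antisymm (hle A h.equilibrium)
    refine ⟨he, h.equilibrium, fun A' hA' => ?_⟩
    simpa [← he] using hle A' hA'
  · rintro ⟨rfl, h⟩
    refine ⟨h.1.isEntryEquilibrium, fun e' A' hA' => ?_⟩
    exact mul_le_mul_of_nonneg_right (hA'.fee_le.trans (h.profit_le hA'.equilibrium)) hpos.le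

/-- A certified minimum quality lets the intermediary earn a positive fee from all types. -/
theorem Market.exists_isEntryEquilibrium_pos (M : Market) :
    ∃ (e : ℝ) (A : RatedMarket), 0 < e ∧ IsEntryEquilibrium M e M.lo A := by
  classical
  have hlo : M.lo ∈ Icc M.lo M.hi := ⟨le_rfl, M.lo_lt_hi.le⟩
  have hcont : ContinuousOn (fun z => costQ M.cost z M.lo) (Ici 0) :=
    M.contDiffOn_costQ.continuousOn.comp (f := fun z => (z, M.lo)) (by fun_prop)
      (fun z hz => ⟨hz, hlo⟩)
  have hev := (hcont 0 (mem_Ici.2 le_rfl)).tendsto.mono_left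
    (nhdsWithin_mono 0 Ioi_subset_Ici_self) |>.eventually_lt_const
    (show costQ M.cost 0 M.lo < 1 by rw [M.costQ_zero _ hlo]; exact one_pos)
  obtain ⟨K, hK1, hK0⟩ := (hev.and self_mem_nhdsWithin).exists
  have hK0 : 0 < K := hK0
  have hcost : ∀ θ ∈ Icc M.lo M.hi, M.cost K θ < K := by
    intro θ hθ
    have h1 := M.antitoneOn_cost hK0.le hlo hθ hθ.1
    have h2 := M.cost_sub_le le_rfl hK0.le hlo
    rw [M.cost_zero _ hlo] at h2
    simp only at h1
    nlinarith
  lift K to ℝ≥0 using hK0.le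
  let g : ℝ≥0 → ℝ≥0 := fun z => if z = K then K else 0
  have hg : Measurable g := Measurable.ite (measurableSet_singleton K) measurable_const
    measurable_const
  have hgK : g K = K := if_pos rfl
  have hq : Measurable fun _ : ℝ => K := measurable_const
  have hA : IsEquilibrium M M.lo (mixingMarket hg hq K) := by
    refine isEquilibrium_mixingMarket hg hq K hlo (integrable_const _) (integrable_const _)
      (by rw [hgK]) (fun θ hθ z => ?_) (fun θ _ => by rw [hgK]; exact left_mem_uIcc)
    rw [hgK]
    by_cases hz : z = K
    · rw [hz, hgK]
    · have h1 : g z = 0 := if_neg hz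
      have h2 := M.cost_nonneg (z := z) z.2 hθ
      have h3 := hcost θ hθ
      rw [h1, NNReal.coe_zero]
      linarith
  refine ⟨_, _, ?_, hA.isEntryEquilibrium⟩
  simp only [RatedMarket.profit, RatedMarket.payoff, expectedPrice_mixingMarket]
  have h1 : (mixingMarket hg hq K).quality M.lo = K := rfl
  rw [h1, hgK]
  exact sub_pos.2 (hcost _ hlo)

theorem IsRevenueMaximizing.cutoff_mem {M : Market} {e c : ℝ} {A : RatedMarket}
    (h : IsRevenueMaximizing M e c A) : c ∈ Ico M.lo M.hi := by
  have hc := h.1.equilibrium.cutoff_mem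
  refine ⟨hc.1, lt_of_le_of_ne hc.2 ?_⟩
  rintro rfl
  obtain ⟨e', A', he', hA'⟩ := M.exists_isEntryEquilibrium_pos
  have h1 := h.2 e' M.lo A' hA'
  have h2 := M.cdf_lt_one ⟨le_rfl, M.lo_lt_hi⟩
  have h3 := mul_pos he' (sub_pos.2 h2)
  simp only [revenue, M.cdf_hi] at h1
  linarith

theorem RatedMarket.measurable_expectedPrice (A : RatedMarket) : Measurable A.expectedPrice := by
  have h : StronglyMeasurable fun s : A.S => (A.price s : ℝ) :=
    A.measurable_price.coe_nnreal_real.stronglyMeasurable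
  exact h.integral_kernel.measurable

/-- An entry equilibrium whose signaled qualities lie between the qualities and a generic quality
is implemented by mixing. -/
theorem IsEntryEquilibrium.isMixing {M : Market} {e c : ℝ} {A : RatedMarket}
    (h : IsEntryEquilibrium M e c A) {x : ℝ≥0}
    (hx : ∀ θ ∈ Ico c M.hi, A.signaled θ ∈ uIcc (A.quality θ : ℝ) x) :
    IsMixing (Icc 0 1) M e c A ∧
      ((∀ θ ∈ Ico c M.hi, A.signaled θ = A.quality θ → (A.quality θ : ℝ) = x) →
        IsMixing (Ico 0 1) M e c A) := by
  let g : ℝ≥0 → ℝ≥0 := fun z => (A.expectedPrice z).toNNReal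
  have hgA : ∀ z, (g z : ℝ) = A.expectedPrice z := fun z =>
    Real.coe_toNNReal _ (A.expectedPrice_nonneg z)
  have hg : Measurable g := A.measurable_expectedPrice.real_toNNReal
  have hx' : ∀ θ ∈ Ico c M.hi, (g (A.quality θ) : ℝ) ∈ uIcc (A.quality θ : ℝ) x := by
    intro θ hθ
    rw [hgA]
    exact hx θ hθ
  obtain ⟨hsi, hsq⟩ := h.equilibrium.integral_signaled
  let A' := mixingMarket hg A.measurable_quality x
  have hpay : ∀ z θ, A'.payoff M z θ = A.payoff M z θ := fun z θ => by
    simp only [A', RatedMarket.payoff, expectedPrice_mixingMarket, hgA]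
  have hprofit : ∀ θ, A'.profit M θ = A.profit M θ := fun θ => hpay (A.quality θ) θ
  have hA' : IsEntryEquilibrium M e c A' := by
    refine ⟨h.fee_nonneg, isEquilibrium_mixingMarket hg A.measurable_quality x
      h.equilibrium.cutoff_mem h.equilibrium.integrable_quality ?_ ?_ ?_ hx', ?_, ?_⟩
    · simp only [hgA]
      exact hsi
    · simp only [hgA]
      exact hsq
    · intro θ hθ z
      simp only [hgA]
      exact h.equilibrium.optimal θ hθ z
    · intro θ hθ
      rw [hprofit]
      exact h.enter θ hθ
    · intro θ hθ z
      rw [hpay]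
      exact h.stay_out θ hθ z
  have main : ∀ I : Set ℝ, (∀ θ ∈ Ico c M.hi, revealProb g x (A.quality θ) ∈ I) →
      IsMixing I M e c A := fun I hI =>
    ⟨revealProb g x, x, fun θ hθ => ⟨hI θ hθ, (hgA _).symm.trans (revealProb_spec (hx' θ hθ))⟩,
      A', hA', fun θ _ => ⟨rfl, (expectedPrice_mixingMarket hg A.measurable_quality x _).trans
        (hgA _)⟩, revealsOrPools_mixingMarket hg A.measurable_quality x hx'⟩
  refine ⟨main _ fun θ hθ => revealProb_mem_Icc (hx' θ hθ), fun hne => main _ fun θ hθ =>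
    ⟨(revealProb_mem_Icc (hx' θ hθ)).1, revealProb_lt_one (hx' θ hθ) fun he => ?_⟩⟩
  rw [hgA] at he
  exact hne θ hθ he

theorem mainTheorem12 (M : Market) :
    (∀ c ∈ Ico M.lo M.hi, ∀ (e : ℝ) (A : RatedMarket),
      IsRevenueMaximizingAt M c e A ↔
        e = A.profit M c ∧ IsParetoOptimal M c (Measure.dirac c) A) ∧
    (∀ (e c : ℝ) (A : RatedMarket), IsRevenueMaximizing M e c A →
      c ∈ Ico M.lo M.hi ∧
      e = A.profit M c ∧
      IsParetoOptimal M c (Measure.dirac c) A ∧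
      (M.StrictlySubmodular → IsFullMixing M e c A) ∧
      (MonotoneOn A.quality (Icc c M.hi) → IsMixing (Icc 0 1) M e c A)) := by
  refine ⟨fun c hc e A => isRevenueMaximizingAt_iff M hc e A, fun e c A h => ?_⟩
  have hc := h.cutoff_mem
  obtain ⟨he, hopt⟩ := (isRevenueMaximizingAt_iff M hc e A).1
    ⟨h.1, fun e' A' hA' => h.2 e' c A' hA'⟩
  have key : MonotoneOn A.quality (Icc c M.hi) →
      ∃ x : ℝ≥0, (∀ θ ∈ Ico c M.hi, A.signaled θ ∈ uIcc (A.quality θ : ℝ) x) ∧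
        ((∀ θ ∈ Ico c M.hi, ∀ θ' ∈ Ico c M.hi, (A.quality θ : ℝ) < A.quality θ' →
          A.signaled θ' - A.quality θ' < A.signaled θ - A.quality θ) →
          ∀ θ ∈ Ico c M.hi, A.signaled θ = A.quality θ → (A.quality θ : ℝ) = x) := by
    intro hmono
    have hA := hopt.1.isContract hmono
    refine M.exists_generic_quality hc hA.monotone_quality ?_
      (fun θ _ => A.expectedPrice_nonneg _) ?_ hopt.1.integral_signaled.2
    · simpa only [A.profit_add_cost] using hA.monotone_signaled hc.1
    · simpa only [A.profit_add_cost] using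
        hA.antitone_signaled_sub hc.1 (hopt.costQ_quality_le_one hc hmono)
  refine ⟨hc, he, hopt, fun hM => ?_, fun hmono => ?_⟩
  · obtain ⟨x, hx, hne⟩ := key (hopt.1.monotoneOn_quality hM)
    exact (h.1.isMixing hx).2 (hne (hopt.signaled_sub_lt hc hM))
  · obtain ⟨x, hx, -⟩ := key hmono
    exact (h.1.isMixing hx).1
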